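/- Let $X=\{X_t\}_{t\ge 0}$ be a Lévy process on $\mathbb{R}^d$ defined on a probability space $(\Omega,\mathcal F,\mathrm P)$: $X_0=0$ almost surely, $X$ has stationary and independent increments, and almost surely its paths $t\mapsto X_t$ are càdlàg. Write $\mathcal R_X:=\{X_t : t\ge 0\}$ for the range of $X$, and let $$U_X(A):=\int_0^\infty \mathrm P\{X_t\in A\}\,dt\qquad (A\subseteq\mathbb R^d \text{ Borel})$$ be its potential measure. Assume that $X$ is transient, that is, that $U_X$ is a Radon measure ($U_X(K)<\infty$ for every compact $K\subset\mathbb R^d$). For $x\in\mathbb R^d$ and $r>0$ put $|x|:=\max_{1\le j\le d}|x_j|$, $B(x;r):=\prod_{j=1}^d[x_j-r,x_j+r)$ and $Q(x):=\prod_{j=1}^d[x_j,x_j+1)$. For $F\subseteq\mathbb R^d$ let $\mathrm{pix}(F):=\{x\in\mathbb Z^d: F\cap Q(x)\ne\varnothing\}$, and define the macroscopic Minkowski dimension of $F$ by $$\mathrm{Dim}_{M}(F):=\limsup_{n\to\infty}\frac1n\,\mathrm{Log}_+\bigl(\#(\mathrm{pix}(F)\cap B(0;2^n))\bigr),\qquad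 \mathrm{Log}_+(y):=\log_2(\max(y,2)).$$ Then, with probability one, $$\mathrm{Dim}_{M}(\mathcal R_X)=\inf\Bigl\{\alpha>0:\ \int_{\mathbb R^d}\frac{U_X(dx)}{1+|x|^\alpha}<\infty\Bigr\}.$$ -/

import Mathlib

open MeasureTheory ProbabilityTheory Set Filter Topology
open scoped NNReal ENNReal

/-! ### Macroscopic Minkowski dimension

Points of `ℝ^d` are functions `Fin d → ℝ`, whose Mathlib norm is `|x| = max_j |x_j|`. -/

/-- The half-open cube `B(x; r) = [x₁ - r, x₁ + r) × ⋯ × [x_d - r, x_d + r)`. -/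
def halfOpenBox {d : ℕ} (x : Fin d → ℝ) (r : ℝ) : Set (Fin d → ℝ) :=
  {y | ∀ i, x i - r ≤ y i ∧ y i < x i + r}

/-- The unit cube `Q(x) = [x₁, x₁ + 1) × ⋯ × [x_d, x_d + 1)`. -/
def unitBox {d : ℕ} (x : Fin d → ℝ) : Set (Fin d → ℝ) :=
  {y | ∀ i, x i ≤ y i ∧ y i < x i + 1}

/-- The inclusion of `ℤ^d` in `ℝ^d`. -/
def latticePt {d : ℕ} (x : Fin d → ℤ) : Fin d → ℝ := fun i => (x i : ℝ)

/-- The pixelization of `F ⊆ ℝ^d`: all `x ∈ ℤ^d` such that `F` meets `Q(x)`. -/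
def pix {d : ℕ} (F : Set (Fin d → ℝ)) : Set (Fin d → ℤ) :=
  {x | (F ∩ unitBox (latticePt x)).Nonempty}

/-- `pix(F) ∩ B(0; 2^n)`, as a set of lattice points. -/
def pixInBox {d : ℕ} (F : Set (Fin d → ℝ)) (n : ℕ) : Set (Fin d → ℤ) :=
  {x | x ∈ pix F ∧ latticePt x ∈ halfOpenBox 0 ((2 : ℝ) ^ n)}

/-- The set counted in the definition of the dimension is finite, so that its `Set.ncard` is
its number of elements. -/
theorem pixInBox_finite {d : ℕ} (F : Set (Fin d → ℝ)) (n : ℕ) : (pixInBox F n).Finite := by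
  refine (Set.finite_Icc (fun _ : Fin d => -(2 : ℤ) ^ n) (fun _ => (2 : ℤ) ^ n)).subset ?_
  rintro x ⟨-, hx⟩
  refine ⟨fun i => ?_, fun i => ?_⟩
  · have h := (hx i).1
    simp only [latticePt, Pi.zero_apply, zero_sub] at h
    exact_mod_cast h
  · have h := (hx i).2.le
    simp only [latticePt, Pi.zero_apply, zero_add] at h
    exact_mod_cast h

/-- `Log₊ y = log₂ (max y 2)`. -/
noncomputable def logPlus (y : ℝ) : ℝ := Real.logb 2 (max y 2)

/-- The macroscopic Minkowski dimension
`Dim_M F = limsup_{n → ∞} n⁻¹ Log₊ |pix(F) ∩ B(0; 2^n)|`, an extended real number. -/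
noncomputable def macroMinkowskiDim {d : ℕ} (F : Set (Fin d → ℝ)) : EReal :=
  limsup (fun n : ℕ => (((n : ℝ)⁻¹ * logPlus ((pixInBox F n).ncard : ℝ) : ℝ) : EReal)) atTop

/-! ### Lévy processes -/

/-- A path `f : [0, ∞) → ℝ^d` is càdlàg: right-continuous with (finite) left limits. -/
def IsCadlag {d : ℕ} (f : ℝ≥0 → Fin d → ℝ) : Prop :=
  ∀ t, ContinuousWithinAt f (Ici t) t ∧ ∃ l, Tendsto f (𝓝[<] t) (𝓝 l)

/-- `X` is a Lévy process on `ℝ^d` under `P`: it starts at the origin, has independent and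
stationary increments, and has càdlàg paths. -/
structure IsLevyProcess {Ω : Type*} [MeasurableSpace Ω] {d : ℕ}
    (X : ℝ≥0 → Ω → Fin d → ℝ) (P : Measure Ω) : Prop where
  measurable : ∀ t, Measurable (X t)
  zero : ∀ᵐ ω ∂P, X 0 ω = 0
  indep : HasIndepIncrements X P
  stationary : ∀ s t, IdentDistrib (fun ω => X (s + t) ω - X s ω) (X t) P P
  cadlag : ∀ᵐ ω ∂P, IsCadlag fun t => X t ω

/-- The range `{X_t(ω) : t ≥ 0}`. -/
def processRange {Ω : Type*} {d : ℕ} (X : ℝ≥0 → Ω → Fin d → ℝ) (ω : Ω) : Set (Fin d → ℝ) :=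
  range fun t => X t ω

/-- The potential measure `U_X = ∫₀^∞ P(X_t ∈ ·) dt`, the mixture of the laws of the `X_t` with
respect to Lebesgue measure on `[0, ∞)`; see `IsLevyProcess.potentialMeasure_apply`. -/
noncomputable def potentialMeasure {Ω : Type*} [MeasurableSpace Ω] {d : ℕ}
    (X : ℝ≥0 → Ω → Fin d → ℝ) (P : Measure Ω) : Measure (Fin d → ℝ) :=
  (volume.restrict (Ici (0 : ℝ))).bind fun t => P.map (X t.toNNReal)

/-- `X` is transient: its potential measure is a Radon measure, that is, finite on compact sets. -/
def IsTransient {Ω : Type*} [MeasurableSpace Ω] {d : ℕ}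
    (X : ℝ≥0 → Ω → Fin d → ℝ) (P : Measure Ω) : Prop :=
  ∀ K : Set (Fin d → ℝ), IsCompact K → potentialMeasure X P K < ∞

/-- The one-dimensional laws of a Lévy process depend measurably on time. -/
theorem IsLevyProcess.measurable_law {Ω : Type*} [MeasurableSpace Ω] {d : ℕ}
    {X : ℝ≥0 → Ω → Fin d → ℝ} {P : Measure Ω} [IsProbabilityMeasure P]
    (hX : IsLevyProcess X P) : Measurable fun t : ℝ≥0 => P.map (X t) := by
  have hp : ∀ t, IsProbabilityMeasure (P.map (X t)) :=
    fun t => Measure.isProbabilityMeasure_map (hX.measurable t).aemeasurable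
  refine Measurable.measure_of_isPiSystem_of_isProbabilityMeasure
    (S := {F : Set (Fin d → ℝ) | IsClosed F})
    (by rw [BorelSpace.measurable_eq (α := Fin d → ℝ), borel_eq_generateFrom_isClosed])
    (fun s hs t ht _ => hs.inter ht) ?_
  intro F hF
  have hpos : ∀ n : ℕ, (0 : ℝ) < 1 / ((n : ℝ) + 1) := fun n => by positivity
  refine measurable_of_tendsto_metrizable
    (f := fun n t => ∫⁻ x, (thickenedIndicator (hpos n) F x : ℝ≥0∞) ∂(P.map (X t))) ?_ ?_
  swap
  · rw [tendsto_pi_nhds]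
    exact fun t => tendsto_lintegral_thickenedIndicator_of_isClosed _ hF hpos
      tendsto_one_div_add_atTop_nhds_zero_nat
  intro n
  set g := thickenedIndicator (hpos n) F
  have hg : Continuous fun x => (g x : ℝ≥0∞) := ENNReal.continuous_coe.comp g.continuous
  let q : ℕ → ℝ≥0 → ℝ≥0 := fun m t => ((⌊t * ((m : ℝ≥0) + 1)⌋₊ : ℝ≥0) + 1) / ((m : ℝ≥0) + 1)
  have hq_ge : ∀ m t, t ≤ q m t := fun m t => by
    rw [le_div_iff₀ (by positivity)]
    exact (Nat.lt_floor_add_one _).le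
  have hq_le : ∀ m t, q m t ≤ t + 1 / ((m : ℝ≥0) + 1) := fun m t => by
    rw [div_le_iff₀ (by positivity), add_mul, one_div, inv_mul_cancel₀ (by positivity)]
    gcongr
    exact Nat.floor_le (by positivity)
  have hq_lim : ∀ t, Tendsto (fun m => q m t) atTop (𝓝[≥] t) := fun t => by
    refine tendsto_nhdsWithin_iff.2 ⟨?_, Eventually.of_forall fun m => hq_ge m t⟩
    refine tendsto_of_tendsto_of_tendsto_of_le_of_le tendsto_const_nhds ?_
      (fun m => hq_ge m t) (fun m => hq_le m t)
    have h0 : Tendsto (fun m : ℕ => 1 / ((m : ℝ≥0) + 1)) atTop (𝓝 0) :=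
      tendsto_one_div_add_atTop_nhds_zero_nat
    simpa using (tendsto_const_nhds (x := t)).add h0
  refine measurable_of_tendsto_metrizable
    (f := fun m t => ∫⁻ x, (g x : ℝ≥0∞) ∂(P.map (X (q m t)))) ?_ ?_
  · intro m
    have : (fun t => ∫⁻ x, (g x : ℝ≥0∞) ∂(P.map (X (q m t))))
        = (fun k : ℕ => ∫⁻ x, (g x : ℝ≥0∞) ∂(P.map (X (((k : ℝ≥0) + 1) / ((m : ℝ≥0) + 1)))))
          ∘ fun t : ℝ≥0 => ⌊t * ((m : ℝ≥0) + 1)⌋₊ := rfl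
    rw [this]
    exact (measurable_of_countable _).comp (Nat.measurable_floor.comp (by fun_prop))
  · rw [tendsto_pi_nhds]
    intro t
    simp_rw [fun s => lintegral_map (μ := P) hg.measurable (hX.measurable s)]
    refine tendsto_lintegral_of_dominated_convergence (fun _ => 1)
      (fun m => hg.measurable.comp (hX.measurable _)) (fun m => ae_of_all _ fun ω => ?_)
      (by simp) ?_
    · exact ENNReal.coe_le_one_iff.2 (thickenedIndicator_le_one (hpos n) F _)
    · filter_upwards [hX.cadlag] with ω hω
      exact (hg.tendsto _).comp (((hω t).1.tendsto).comp (hq_lim t))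

/-- `U_X(A) = ∫₀^∞ P(X_t ∈ A) dt` for a Lévy process `X` and a Borel set `A`. -/
theorem IsLevyProcess.potentialMeasure_apply {Ω : Type*} [MeasurableSpace Ω] {d : ℕ}
    {X : ℝ≥0 → Ω → Fin d → ℝ} {P : Measure Ω} [IsProbabilityMeasure P]
    (hX : IsLevyProcess X P) {A : Set (Fin d → ℝ)} (hA : MeasurableSet A) :
    potentialMeasure X P A = ∫⁻ t in Ici (0 : ℝ), P {ω | X t.toNNReal ω ∈ A} := by
  have hm : Measurable fun t : ℝ => P.map (X t.toNNReal) :=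
    hX.measurable_law.comp measurable_real_toNNReal
  rw [potentialMeasure, Measure.bind_apply hA hm.aemeasurable]
  exact lintegral_congr fun t => Measure.map_apply (hX.measurable _) hA

/-!
The dimension of the range is governed by a random walk embedded in the process. By right-continuity
at the origin there is a step `h > 0` such that the displacement over any given time interval of
length at most `h` is less than `1` with probability at least `1/2`. Let `S` be the process at the
multiples of `h` and let `g n` be the Green measure of `B(0; 2^n)` for `S`, the expected number of
visits. Up to constants and a change of `n` by one, `g n` is the potential measure of `B(0; 2^n)`
(`IsLevyProcess.potentialMeasure_le_green`, `IsLevyProcess.green_le_potentialMeasure`), and the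
infimum in the theorem is the exponential growth rate of these masses
(`measure_box_le_of_lintegral`, `lintegral_lt_top_of_eventually`). It remains to show that
the number of pixels of the range in `B(0; 2^n)` has the same growth rate as `g n`.

*Upper bound.* If the process hits a unit cube, then with probability at least `1/2` the walk `S`
visits a neighbourhood of the cube soon after. To avoid stopping times in continuous time, this is
shown for the first visit of each dyadic refinement of `S` (`IsRandomWalk.measure_exists_mem_le`);
the refinements come close to every point of the range. Summing over the cubes bounds the expected
number of pixels by a constant times `g (n + 1)`, and the Borel–Cantelli lemma applies
(`IsLevyProcess.ae_macroMinkowskiDim_le`).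

*Lower bound.* The range of `S` suffices. The Markov property gives a maximum principle for the
Green measure (`IsRandomWalk.green_le_of_sub_mem`), hence a doubling property of `g`, and a second
moment bound for occupation times (`IsRandomWalk.lintegral_occupation_sq_le`). The occupation time
of `B(0; 2^n)` has mean `g n` and second moment of order `(g n)^2`, while the sum of the squared
occupation times of the single pixels has mean of order `g n` only. So with probability bounded
below the occupation time is spread over at least a constant times `g n` pixels
(`IsRandomWalk.measure_ncard_pixInBox_ge`), and this happens infinitely often with positive
probability. The dimension does not change under bounded perturbations
(`macroMinkowskiDim_le_of_near`), so it is a tail function of the steps of `S`, and Kolmogorov's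
zero-one law turns positive probability into probability one
(`IsRandomWalk.ae_le_macroMinkowskiDim`).
-/

/-! ### Counting pixels -/

/-- The lattice point `(⌊y₁⌋, …, ⌊y_d⌋)` labelling the unit cube that contains `y`. -/
noncomputable def cell {d : ℕ} (y : Fin d → ℝ) : Fin d → ℤ := fun i => ⌊y i⌋

theorem mem_unitBox_latticePt {d : ℕ} {y : Fin d → ℝ} {x : Fin d → ℤ} :
    y ∈ unitBox (latticePt x) ↔ cell y = x := by
  simp only [unitBox, latticePt, mem_ofPred_eq, cell, funext_iff, Int.floor_eq_iff]

theorem mem_pix {d : ℕ} {F : Set (Fin d → ℝ)} {x : Fin d → ℤ} :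
    x ∈ pix F ↔ ∃ y ∈ F, cell y = x := by
  simp only [pix, Set.Nonempty, mem_inter_iff, mem_unitBox_latticePt, mem_ofPred_eq]

theorem mem_halfOpenBox_zero {d : ℕ} {y : Fin d → ℝ} {r : ℝ} :
    y ∈ halfOpenBox 0 r ↔ ∀ i, -r ≤ y i ∧ y i < r := by
  simp [halfOpenBox]

/-- The cube `B(0; 2^n)` is a union of lattice unit cubes. -/
theorem latticePt_cell_mem_box {d : ℕ} {y : Fin d → ℝ} {n : ℕ} :
    latticePt (cell y) ∈ halfOpenBox 0 ((2 : ℝ) ^ n) ↔ y ∈ halfOpenBox 0 ((2 : ℝ) ^ n) := by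
  simp only [mem_halfOpenBox_zero, latticePt, cell]
  refine forall_congr' fun i => and_congr ?_ ?_
  · have : (-(2 : ℝ) ^ n) = ((-2 ^ n : ℤ) : ℝ) := by push_cast; rfl
    rw [this, Int.cast_le, Int.le_floor]
  · have : ((2 : ℝ) ^ n) = ((2 ^ n : ℤ) : ℝ) := by push_cast; rfl
    rw [this, Int.cast_lt, Int.floor_lt]

/-- The lattice points of `B(0; 2^n)`, as a finite set. -/
noncomputable def boxPts (d n : ℕ) : Finset (Fin d → ℤ) :=
  (pixInBox_finite (univ : Set (Fin d → ℝ)) n).toFinset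

theorem mem_boxPts {d n : ℕ} {x : Fin d → ℤ} :
    x ∈ boxPts d n ↔ latticePt x ∈ halfOpenBox 0 ((2 : ℝ) ^ n) := by
  simp only [boxPts, Finite.mem_toFinset, pixInBox, mem_ofPred_eq, and_iff_right_iff_imp]
  intro _
  exact mem_pix.2 ⟨latticePt x, mem_univ _, by ext i; simp [cell, latticePt]⟩

open Classical in
theorem ncard_pixInBox {d : ℕ} (F : Set (Fin d → ℝ)) (n : ℕ) :
    (pixInBox F n).ncard = ((boxPts d n).filter (· ∈ pix F)).card := by
  rw [← Set.ncard_coe_finset]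
  congr 1
  ext x
  simp [pixInBox, mem_boxPts, and_comm]

/-! ### Growth rates and the dimension -/

theorem macroMinkowskiDim_nonneg {d : ℕ} (F : Set (Fin d → ℝ)) : 0 ≤ macroMinkowskiDim F := by
  refine le_limsup_of_frequently_le (Eventually.frequently (Eventually.of_forall fun n => ?_))
  rw [← EReal.coe_zero, EReal.coe_le_coe_iff]
  exact mul_nonneg (by positivity)
    (Real.logb_nonneg one_lt_two (le_trans one_le_two (le_max_right _ _)))

theorem macroMinkowskiDim_le_of_eventually {d : ℕ} {F : Set (Fin d → ℝ)} {b C : ℝ} (hb : 0 ≤ b)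
    (h : ∀ᶠ n : ℕ in atTop, ((pixInBox F n).ncard : ℝ) ≤ C * 2 ^ (b * n)) :
    macroMinkowskiDim F ≤ b := by
  set C' := max C 2
  have hlim : Tendsto (fun n : ℕ => (((n : ℝ)⁻¹ * Real.logb 2 C' + b : ℝ) : EReal)) atTop
      (𝓝 (b : EReal)) := by
    refine (continuous_coe_real_ereal.tendsto b).comp ?_
    simpa using ((tendsto_inv_atTop_nhds_zero_nat (𝕜 := ℝ)).mul_const (Real.logb 2 C')).add_const b
  rw [← hlim.limsup_eq]
  refine limsup_le_limsup ?_
  filter_upwards [h, eventually_gt_atTop 0] with n hn hn0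
  rw [EReal.coe_le_coe_iff]
  have hn0' : (0 : ℝ) < n := by exact_mod_cast hn0
  have hC' : (0 : ℝ) < C' := lt_of_lt_of_le two_pos (le_max_right _ _)
  have hpow : (1 : ℝ) ≤ 2 ^ (b * n) := Real.one_le_rpow one_le_two (by positivity)
  have h1 : logPlus ((pixInBox F n).ncard : ℝ) ≤ Real.logb 2 C' + b * n := by
    have : Real.logb 2 (C' * 2 ^ (b * n)) = Real.logb 2 C' + b * n := by
      rw [Real.logb_mul hC'.ne' (by positivity), Real.logb_rpow two_pos (by norm_num)]
    rw [← this]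
    refine Real.logb_le_logb_of_le one_lt_two (by positivity) (max_le ?_ ?_)
    · exact hn.trans (by gcongr; exact le_max_left _ _)
    · calc (2 : ℝ) ≤ C' * 1 := by rw [mul_one]; exact le_max_right _ _
        _ ≤ _ := by gcongr
  calc (n : ℝ)⁻¹ * logPlus ((pixInBox F n).ncard : ℝ)
      ≤ (n : ℝ)⁻¹ * (Real.logb 2 C' + b * n) := by gcongr
    _ = _ := by field_simp

theorem eventually_ncard_le_of_macroMinkowskiDim_lt {d : ℕ} {F : Set (Fin d → ℝ)} {b : ℝ}
    (h : macroMinkowskiDim F < b) :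
    ∀ᶠ n : ℕ in atTop, ((pixInBox F n).ncard : ℝ) ≤ 2 ^ (b * n) := by
  filter_upwards [eventually_lt_of_limsup_lt h, eventually_gt_atTop 0] with n hn hn0
  rw [EReal.coe_lt_coe_iff] at hn
  have hn0' : (0 : ℝ) < n := by exact_mod_cast hn0
  rw [inv_mul_lt_iff₀ hn0'] at hn
  refine (le_max_left _ (2 : ℝ)).trans ?_
  rw [mul_comm, ← Real.logb_le_iff_le_rpow one_lt_two (lt_of_lt_of_le two_pos (le_max_right _ _))]
  exact hn.le

theorem le_macroMinkowskiDim_of_frequently {d : ℕ} {F : Set (Fin d → ℝ)} {b c : ℝ} (hc : 0 < c)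
    (h : ∃ᶠ n : ℕ in atTop, c * 2 ^ (b * n) ≤ ((pixInBox F n).ncard : ℝ)) :
    (b : EReal) ≤ macroMinkowskiDim F := by
  by_contra! hlt
  obtain ⟨b', hb', hbb'⟩ := EReal.lt_iff_exists_real_btwn.1 hlt
  rw [EReal.coe_lt_coe_iff] at hbb'
  have hlim : Tendsto (fun n : ℕ => c * 2 ^ ((b - b') * n)) atTop atTop := by
    refine Tendsto.const_mul_atTop hc ?_
    refine (tendsto_rpow_atTop_of_base_gt_one 2 one_lt_two).comp ?_
    exact Tendsto.const_mul_atTop (sub_pos.2 hbb') tendsto_natCast_atTop_atTop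
  obtain ⟨n, h1, h2, h3⟩ := (h.and_eventually
    ((eventually_ncard_le_of_macroMinkowskiDim_lt hb').and (hlim.eventually_gt_atTop 1))).exists
  have h4 : c * 2 ^ (b * n) = c * 2 ^ ((b - b') * n) * 2 ^ (b' * n) := by
    rw [mul_assoc, ← Real.rpow_add two_pos]; ring_nf
  have h5 : (0 : ℝ) < 2 ^ (b' * n) := by positivity
  nlinarith

/-- Pixels of `F` in `B(0; 2^n)` are pixels of `G` in `B(0; 2^(n+1))` up to a bounded shift. -/
theorem ncard_pixInBox_le_of_near {d : ℕ} {F G : Set (Fin d → ℝ)} {R : ℕ}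
    (h : ∀ f ∈ F, ∃ g ∈ G, ‖f - g‖ ≤ R) {n : ℕ} (hn : (R : ℝ) + 1 ≤ 2 ^ n) :
    (pixInBox F n).ncard ≤ (2 * (R + 1) + 1) ^ d * (pixInBox G (n + 1)).ncard := by
  classical
  set V : Finset (Fin d → ℤ) := Finset.Icc (fun _ => -((R : ℤ) + 1)) (fun _ => (R : ℤ) + 1)
  set T := (pixInBox_finite G (n + 1)).toFinset
  have hsub : pixInBox F n ⊆ ((V ×ˢ T).image fun p => p.1 + p.2 : Finset (Fin d → ℤ)) := by
    rintro x ⟨hx, hxn⟩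
    obtain ⟨f, hf, rfl⟩ := mem_pix.1 hx
    obtain ⟨g, hg, hfg⟩ := h f hf
    have hi : ∀ i, |f i - g i| ≤ R := fun i => (norm_le_pi_norm (f - g) i).trans hfg
    rw [latticePt_cell_mem_box, mem_halfOpenBox_zero] at hxn
    simp only [Finset.coe_image, mem_image, Finset.mem_coe, Finset.mem_product]
    refine ⟨(cell f - cell g, cell g), ⟨?_, ?_⟩, by simp⟩
    · rw [Finset.mem_Icc]
      have key : ∀ i, -((R : ℤ) + 1) ≤ ⌊f i⌋ - ⌊g i⌋ ∧ ⌊f i⌋ - ⌊g i⌋ ≤ (R : ℤ) + 1 := by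
        intro i
        have h1 := abs_le.1 (hi i)
        have h2 := Int.floor_le (f i)
        have h3 := Int.floor_le (g i)
        have h4 := Int.lt_floor_add_one (f i)
        have h5 := Int.lt_floor_add_one (g i)
        constructor
        · have : (-((R : ℝ) + 1)) < (⌊f i⌋ : ℝ) - ⌊g i⌋ := by linarith
          exact_mod_cast this.le
        · have : (⌊f i⌋ : ℝ) - ⌊g i⌋ < (R : ℝ) + 1 := by linarith
          exact_mod_cast this.le
      exact ⟨fun i => (key i).1, fun i => (key i).2⟩
    · rw [Finite.mem_toFinset]
      refine ⟨mem_pix.2 ⟨g, hg, rfl⟩, ?_⟩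
      rw [latticePt_cell_mem_box, mem_halfOpenBox_zero]
      intro i
      have h1 := abs_le.1 (hi i)
      have h2 := hxn i
      rw [pow_succ]
      constructor <;> linarith
  have hV : V.card = (2 * (R + 1) + 1) ^ d := by
    rw [Pi.card_Icc]
    simp only [Int.card_Icc, Finset.prod_const, Finset.card_univ, Fintype.card_fin]
    congr 1
    omega
  calc (pixInBox F n).ncard
      ≤ ((V ×ˢ T).image fun p => p.1 + p.2).card := by
        rw [← Set.ncard_coe_finset]; exact Set.ncard_le_ncard hsub (Finset.finite_toSet _)
    _ ≤ (V ×ˢ T).card := Finset.card_image_le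
    _ = _ := by
        rw [Finset.card_product, hV, ← Set.ncard_eq_toFinset_card _ (pixInBox_finite G (n + 1))]

/-- The dimension sees only the large-scale shape: it does not increase when passing to a set
within bounded distance. -/
theorem macroMinkowskiDim_le_of_near {d : ℕ} {F G : Set (Fin d → ℝ)} {c : ℝ}
    (h : ∀ f ∈ F, ∃ g ∈ G, ‖f - g‖ ≤ c) : macroMinkowskiDim F ≤ macroMinkowskiDim G := by
  obtain ⟨R, hR⟩ := exists_nat_ge c
  have h' : ∀ f ∈ F, ∃ g ∈ G, ‖f - g‖ ≤ R := fun f hf =>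
    (h f hf).imp fun g hg => ⟨hg.1, hg.2.trans hR⟩
  refine EReal.le_of_forall_lt_iff_le.1 fun b hb => ?_
  have hb0 : 0 ≤ b := by exact_mod_cast (macroMinkowskiDim_nonneg G).trans hb.le
  refine macroMinkowskiDim_le_of_eventually (C := (2 * (R + 1) + 1) ^ d * 2 ^ b) hb0 ?_
  have hev := (tendsto_add_atTop_nat 1).eventually (eventually_ncard_le_of_macroMinkowskiDim_lt hb)
  filter_upwards [hev, (tendsto_pow_atTop_atTop_of_one_lt (one_lt_two (α := ℝ))).eventually_ge_atTop
    ((R : ℝ) + 1)] with n h1 h2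
  calc ((pixInBox F n).ncard : ℝ)
      ≤ (2 * (R + 1) + 1) ^ d * ((pixInBox G (n + 1)).ncard : ℝ) := by
        exact_mod_cast ncard_pixInBox_le_of_near h' h2
    _ ≤ (2 * (R + 1) + 1) ^ d * 2 ^ (b * (n + 1 : ℕ)) := by gcongr
    _ = _ := by
        rw [mul_assoc, ← Real.rpow_add two_pos]; push_cast; ring_nf

/-! ### Measurability -/

theorem measurableSet_unitBox {d : ℕ} (x : Fin d → ℝ) : MeasurableSet (unitBox x) := by
  have : unitBox x = univ.pi fun i => Ico (x i) (x i + 1) := by ext; simp [unitBox]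
  rw [this]
  exact MeasurableSet.univ_pi fun i => measurableSet_Ico

theorem measurableSet_halfOpenBox {d : ℕ} (x : Fin d → ℝ) (r : ℝ) :
    MeasurableSet (halfOpenBox x r) := by
  have : halfOpenBox x r = univ.pi fun i => Ico (x i - r) (x i + r) := by
    ext; simp [halfOpenBox]
  rw [this]
  exact MeasurableSet.univ_pi fun i => measurableSet_Ico

theorem mem_pix_range_iff {d : ℕ} {ι : Type*} (s : ι → Fin d → ℝ) (x : Fin d → ℤ) :
    x ∈ pix (range s) ↔ ∃ k, s k ∈ unitBox (latticePt x) := by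
  simp [mem_pix, mem_unitBox_latticePt]

theorem measurableSet_mem_pix {Ω ι : Type*} [Countable ι] {m : MeasurableSpace Ω} {d : ℕ}
    {S : ι → Ω → Fin d → ℝ} (hS : ∀ k, Measurable (S k)) (x : Fin d → ℤ) :
    MeasurableSet {ω | x ∈ pix (range fun k => S k ω)} := by
  simp only [mem_pix_range_iff, ofPred_exists]
  exact MeasurableSet.iUnion fun k => hS k (measurableSet_unitBox _)

theorem measurable_ncard_pixInBox {Ω ι : Type*} [Countable ι] {m : MeasurableSpace Ω} {d : ℕ}
    {S : ι → Ω → Fin d → ℝ} (hS : ∀ k, Measurable (S k)) (n : ℕ) :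
    Measurable fun ω => (pixInBox (range fun k => S k ω) n).ncard := by
  classical
  simp only [ncard_pixInBox, Finset.card_filter]
  exact Finset.measurable_sum _ fun x _ =>
    Measurable.ite (measurableSet_mem_pix hS x) measurable_const measurable_const

theorem measurable_macroMinkowskiDim {Ω ι : Type*} [Countable ι] {m : MeasurableSpace Ω} {d : ℕ}
    {S : ι → Ω → Fin d → ℝ} (hS : ∀ k, Measurable (S k)) :
    Measurable fun ω => macroMinkowskiDim (range fun k => S k ω) := by
  refine Measurable.limsup fun n => ?_
  exact (measurable_of_countable fun N : ℕ =>
    (((n : ℝ)⁻¹ * logPlus (N : ℝ) : ℝ) : EReal)).comp (measurable_ncard_pixInBox hS n)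

/-! ### Random walks and their Green measures -/

/-- A random walk on `ℝ^d` started at the origin. Stationarity is stated for increments over
arbitrary blocks of time. -/
structure IsRandomWalk {Ω : Type*} [MeasurableSpace Ω] {d : ℕ}
    (S : ℕ → Ω → Fin d → ℝ) (P : Measure Ω) : Prop where
  measurable : ∀ k, Measurable (S k)
  zero : ∀ ω, S 0 ω = 0
  indep : iIndepFun (fun i ω => S (i + 1) ω - S i ω) P
  stationary : ∀ k l, IdentDistrib (fun ω => S (k + l) ω - S k ω) (S l) P P

/-- The `σ`-algebra generated by the steps of the walk with index in `I`. -/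
@[reducible]
def stepAlgebra {Ω : Type*} {d : ℕ} (S : ℕ → Ω → Fin d → ℝ) (I : Set ℕ) : MeasurableSpace Ω :=
  ⨆ i ∈ I, MeasurableSpace.comap (fun ω => S (i + 1) ω - S i ω) inferInstance

/-- The number of times at which the walk is in `A`. -/
noncomputable def occupation {Ω : Type*} {d : ℕ} (S : ℕ → Ω → Fin d → ℝ)
    (A : Set (Fin d → ℝ)) (ω : Ω) : ℝ≥0∞ := ∑' k, A.indicator 1 (S k ω)

/-- The Green measure of `A`: the expected number of times at which the walk is in `A`. -/
noncomputable def green {Ω : Type*} [MeasurableSpace Ω] {d : ℕ} (S : ℕ → Ω → Fin d → ℝ)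
    (P : Measure Ω) (A : Set (Fin d → ℝ)) : ℝ≥0∞ := ∑' k, P {ω | S k ω ∈ A}

/-- The event that the walk visits `A` for the first time at time `j`. -/
def firstVisit {Ω : Type*} {d : ℕ} (S : ℕ → Ω → Fin d → ℝ) (A : Set (Fin d → ℝ)) (j : ℕ) :
    Set Ω := {ω | S j ω ∈ A ∧ ∀ i < j, S i ω ∉ A}

theorem ENNReal.tsum_eq_tsum_nat_add {f : ℕ → ℝ≥0∞} {j : ℕ} (h : ∀ i < j, f i = 0) :
    ∑' k, f k = ∑' l, f (l + j) := by
  rw [← Summable.sum_add_tsum_nat_add' (k := j) ENNReal.summable,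
    Finset.sum_eq_zero fun i hi => h i (Finset.mem_range.1 hi), zero_add]

section Walk

variable {Ω : Type*} {d : ℕ} {S : ℕ → Ω → Fin d → ℝ}

theorem measurable_stepAlgebra_sub {I : Set ℕ} {j k : ℕ} (hjk : j ≤ k) (hI : Ico j k ⊆ I) :
    Measurable[stepAlgebra S I] fun ω => S k ω - S j ω := by
  induction k, hjk using Nat.le_induction with
  | base => simp
  | succ k hk ih =>
    have h1 := ih ((Ico_subset_Ico_right (Nat.le_succ k)).trans hI)
    have h2 : Measurable[stepAlgebra S I] fun ω => S (k + 1) ω - S k ω := by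
      refine (comap_measurable _).mono ?_ le_rfl
      exact le_iSup₂_of_le (f := fun i (_ : i ∈ I) =>
        MeasurableSpace.comap (fun ω => S (i + 1) ω - S i ω) inferInstance) k
        (hI ⟨hk, Nat.lt_succ_self k⟩) le_rfl
    have h3 := h2.add h1
    have h4 : (fun ω => S (k + 1) ω - S j ω)
        = (fun ω => S (k + 1) ω - S k ω) + fun ω => S k ω - S j ω := by
      ext; simp
    rwa [h4]

theorem firstVisit_disjoint (A : Set (Fin d → ℝ)) :
    Pairwise (Function.onFun Disjoint (firstVisit S A)) := by
  have key : ∀ i j, i < j → Disjoint (firstVisit S A i) (firstVisit S A j) := fun i j hij =>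
    Set.disjoint_left.2 fun ω hi hj => hj.2 i hij hi.1
  intro i j hij
  rcases lt_or_gt_of_ne hij with h | h
  · exact key i j h
  · exact (key j i h).symm

theorem iUnion_firstVisit (A : Set (Fin d → ℝ)) :
    ⋃ j, firstVisit S A j = {ω | ∃ k, S k ω ∈ A} := by
  classical
  ext ω
  simp only [firstVisit, mem_iUnion, mem_ofPred_eq]
  constructor
  · rintro ⟨j, hj, -⟩
    exact ⟨j, hj⟩
  · intro h
    exact ⟨Nat.find h, Nat.find_spec h, fun i hi => Nat.find_min h hi⟩

variable [MeasurableSpace Ω] {P : Measure Ω}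

namespace IsRandomWalk

theorem stepAlgebra_le (hS : IsRandomWalk S P) (I : Set ℕ) :
    stepAlgebra S I ≤ ‹MeasurableSpace Ω› :=
  iSup₂_le fun i _ => ((hS.measurable (i + 1)).sub (hS.measurable i)).comap_le

theorem measurable_stepAlgebra (hS : IsRandomWalk S P) {j k : ℕ} (hjk : j ≤ k) :
    Measurable[stepAlgebra S (Iio k)] (S j) := by
  have h := measurable_stepAlgebra_sub (S := S) (I := Iio k) (Nat.zero_le j)
    fun i hi => lt_of_lt_of_le hi.2 hjk
  simpa [hS.zero] using! h

/-- The Markov property: an increment is independent of the past. -/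
theorem measure_inter_sub_mem (hS : IsRandomWalk S P) {k : ℕ} (l : ℕ) {F : Set Ω}
    (hF : MeasurableSet[stepAlgebra S (Iio k)] F) {B : Set (Fin d → ℝ)} (hB : MeasurableSet B) :
    P (F ∩ {ω | S (k + l) ω - S k ω ∈ B}) = P F * P {ω | S l ω ∈ B} := by
  have hind : Indep (stepAlgebra S (Iio k)) (stepAlgebra S (Ici k)) P :=
    indep_iSup_of_disjoint (fun i => ((hS.measurable (i + 1)).sub (hS.measurable i)).comap_le)
      hS.indep (Iio_disjoint_Ici le_rfl)
  have hm := measurable_stepAlgebra_sub (S := S) (I := Ici k) (Nat.le_add_right k l)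
    fun i hi => hi.1
  rw [Indep_iff] at hind
  refine (hind F _ hF (hm hB)).trans ?_
  congr 1
  exact (hS.stationary k l).measure_mem_eq hB

theorem measurableSet_firstVisit (hS : IsRandomWalk S P) {A : Set (Fin d → ℝ)}
    (hA : MeasurableSet A) (j : ℕ) :
    MeasurableSet[stepAlgebra S (Iio j)] (firstVisit S A j) := by
  have : firstVisit S A j = S j ⁻¹' A ∩ ⋂ i ∈ Iio j, (S i ⁻¹' A)ᶜ := by
    ext ω; simp [firstVisit]
  rw [this]
  refine MeasurableSet.inter (hS.measurable_stepAlgebra le_rfl hA) ?_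
  refine MeasurableSet.biInter (Set.to_countable _) fun i hi => MeasurableSet.compl ?_
  exact hS.measurable_stepAlgebra (le_of_lt hi) hA

theorem tsum_measure_firstVisit (hS : IsRandomWalk S P) {A : Set (Fin d → ℝ)}
    (hA : MeasurableSet A) : ∑' j, P (firstVisit S A j) = P {ω | ∃ k, S k ω ∈ A} := by
  rw [← iUnion_firstVisit, measure_iUnion (firstVisit_disjoint A)
    fun j => hS.stepAlgebra_le _ _ (hS.measurableSet_firstVisit hA j)]

theorem measurable_indicator (hS : IsRandomWalk S P) {A : Set (Fin d → ℝ)}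
    (hA : MeasurableSet A) (k : ℕ) :
    Measurable fun ω => A.indicator (1 : (Fin d → ℝ) → ℝ≥0∞) (S k ω) :=
  (measurable_one.indicator hA).comp (hS.measurable k)

theorem measurable_occupation (hS : IsRandomWalk S P) {A : Set (Fin d → ℝ)}
    (hA : MeasurableSet A) : Measurable (occupation S A) :=
  Measurable.tsum fun k => hS.measurable_indicator hA k

theorem lintegral_occupation (hS : IsRandomWalk S P) {A : Set (Fin d → ℝ)}
    (hA : MeasurableSet A) : ∫⁻ ω, occupation S A ω ∂P = green S P A := by
  unfold occupation green
  rw [lintegral_tsum fun k => (hS.measurable_indicator hA k).aemeasurable]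
  congr 1 with k
  exact lintegral_indicator_one (hS.measurable k hA)

/-- The maximum principle for the Green measure: once the walk has entered `A`, its position
relative to the entrance point must lie in `B ⊇ A - A` whenever it is in `A`. -/
theorem green_le_of_sub_mem (hS : IsRandomWalk S P) [IsProbabilityMeasure P]
    {A B : Set (Fin d → ℝ)} (hA : MeasurableSet A) (hB : MeasurableSet B)
    (hAB : ∀ a ∈ A, ∀ a' ∈ A, a' - a ∈ B) : green S P A ≤ green S P B := by
  have hpt : ∀ ω, occupation S A ω ≤
      ∑' j, ∑' l, (firstVisit S A j ∩ {ω | S (j + l) ω - S j ω ∈ B}).indicator 1 ω := by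
    intro ω
    by_cases h : ∃ k, S k ω ∈ A
    · have h' : ω ∈ ⋃ j, firstVisit S A j := by rw [iUnion_firstVisit]; exact h
      obtain ⟨j, hj⟩ := mem_iUnion.1 h'
      refine le_trans ?_ (ENNReal.le_tsum j)
      rw [occupation, ENNReal.tsum_eq_tsum_nat_add fun i hi => indicator_of_notMem (hj.2 i hi) _]
      refine ENNReal.tsum_le_tsum fun l => ?_
      by_cases hl : S (l + j) ω ∈ A
      · have hmem : ω ∈ firstVisit S A j ∩ {ω | S (j + l) ω - S j ω ∈ B} :=
          ⟨hj, hAB _ hj.1 _ (by rwa [add_comm])⟩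
        rw [indicator_of_mem hl, indicator_of_mem hmem]
        exact le_rfl
      · rw [indicator_of_notMem hl]
        exact zero_le
    · push Not at h
      have : occupation S A ω = 0 := by
        rw [occupation, ENNReal.tsum_eq_zero]
        exact fun k => indicator_of_notMem (h k) _
      rw [this]
      exact zero_le
  have hF := fun j => hS.measurableSet_firstVisit hA j
  have hF' := fun j => hS.stepAlgebra_le _ _ (hF j)
  have hm : ∀ j l, MeasurableSet (firstVisit S A j ∩ {ω | S (j + l) ω - S j ω ∈ B}) :=
    fun j l => (hF' j).inter (((hS.measurable _).sub (hS.measurable _)) hB)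
  have hm' : ∀ j l, Measurable
      ((firstVisit S A j ∩ {ω | S (j + l) ω - S j ω ∈ B}).indicator (1 : Ω → ℝ≥0∞)) :=
    fun j l => measurable_one.indicator (hm j l)
  rw [← hS.lintegral_occupation hA]
  calc ∫⁻ ω, occupation S A ω ∂P
      ≤ ∫⁻ ω, ∑' j, ∑' l,
        (firstVisit S A j ∩ {ω | S (j + l) ω - S j ω ∈ B}).indicator 1 ω ∂P :=
        lintegral_mono hpt
    _ = ∑' j, ∑' l, P (firstVisit S A j) * P {ω | S l ω ∈ B} := by
        rw [lintegral_tsum fun j => (Measurable.tsum fun l => hm' j l).aemeasurable]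
        congr 1 with j
        rw [lintegral_tsum fun l => (hm' j l).aemeasurable]
        congr 1 with l
        rw [lintegral_indicator_one (hm j l), hS.measure_inter_sub_mem l (hF j) hB]
    _ = P {ω | ∃ k, S k ω ∈ A} * green S P B := by
        simp_rw [ENNReal.tsum_mul_left, ENNReal.tsum_mul_right, hS.tsum_measure_firstVisit hA]
        rfl
    _ ≤ green S P B := mul_le_of_le_one_left' prob_le_one

/-- The second moment of the occupation time. -/
theorem lintegral_occupation_sq_le (hS : IsRandomWalk S P)
    {A B : Set (Fin d → ℝ)} (hA : MeasurableSet A) (hB : MeasurableSet B)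
    (hAB : ∀ a ∈ A, ∀ a' ∈ A, a' - a ∈ B) :
    ∫⁻ ω, occupation S A ω ^ 2 ∂P ≤ 2 * (green S P A * green S P B) := by
  -- each pair of visits is recorded by the earlier one and the displacement between the two
  have hpt : ∀ ω, occupation S A ω ^ 2 ≤
      2 * ∑' j, ∑' l, (S j ⁻¹' A ∩ {ω | S (j + l) ω - S j ω ∈ B}).indicator 1 ω := by
    intro ω
    set a : ℕ → ℝ≥0∞ := fun k => A.indicator 1 (S k ω)
    have ha : occupation S A ω = ∑' k, a k := rfl
    have h1 : ∀ j, ∑' k, (if j ≤ k then a j * a k else 0) ≤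
        ∑' l, (S j ⁻¹' A ∩ {ω | S (j + l) ω - S j ω ∈ B}).indicator 1 ω := by
      intro j
      rw [ENNReal.tsum_eq_tsum_nat_add (j := j) fun i hi => if_neg (not_le.2 hi)]
      refine ENNReal.tsum_le_tsum fun l => ?_
      rw [if_pos (Nat.le_add_left j l)]
      by_cases hj : S j ω ∈ A
      · by_cases hl : S (l + j) ω ∈ A
        · have hmem : ω ∈ S j ⁻¹' A ∩ {ω | S (j + l) ω - S j ω ∈ B} :=
            ⟨hj, hAB _ hj _ (by rwa [add_comm])⟩
          rw [indicator_of_mem hmem]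
          simp only [a, indicator_of_mem hj, indicator_of_mem hl, Pi.one_apply, mul_one, le_refl]
        · simp only [a, indicator_of_notMem hl, mul_zero]
          exact zero_le
      · simp only [a, indicator_of_notMem hj, zero_mul]
        exact zero_le
    calc occupation S A ω ^ 2 = ∑' j, ∑' k, a j * a k := by
          rw [ha, sq]; simp_rw [ENNReal.tsum_mul_left, ENNReal.tsum_mul_right]
      _ ≤ ∑' j, ∑' k, ((if j ≤ k then a j * a k else 0) + if k ≤ j then a k * a j else 0) := by
          gcongr with j k
          rcases le_total j k with h | h
          · rw [if_pos h]; exact le_self_add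
          · rw [if_pos h, mul_comm (a k)]; exact le_add_self
      _ = 2 * ∑' j, ∑' k, (if j ≤ k then a j * a k else 0) := by
          simp_rw [ENNReal.tsum_add]
          rw [ENNReal.tsum_comm (f := fun j k => if k ≤ j then a k * a j else 0), two_mul]
      _ ≤ _ := mul_le_mul_right (ENNReal.tsum_le_tsum h1) 2
  have hF : ∀ j, MeasurableSet[stepAlgebra S (Iio j)] (S j ⁻¹' A) :=
    fun j => hS.measurable_stepAlgebra le_rfl hA
  have hm : ∀ j l, MeasurableSet (S j ⁻¹' A ∩ {ω | S (j + l) ω - S j ω ∈ B}) :=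
    fun j l => (hS.measurable j hA).inter (((hS.measurable _).sub (hS.measurable _)) hB)
  have hm' : ∀ j l, Measurable
      ((S j ⁻¹' A ∩ {ω | S (j + l) ω - S j ω ∈ B}).indicator (1 : Ω → ℝ≥0∞)) :=
    fun j l => measurable_one.indicator (hm j l)
  calc ∫⁻ ω, occupation S A ω ^ 2 ∂P
      ≤ ∫⁻ ω, 2 * ∑' j, ∑' l,
        (S j ⁻¹' A ∩ {ω | S (j + l) ω - S j ω ∈ B}).indicator 1 ω ∂P := lintegral_mono hpt
    _ = 2 * ∑' j, ∑' l, P (S j ⁻¹' A) * P {ω | S l ω ∈ B} := by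
        rw [lintegral_const_mul _ (Measurable.tsum fun j => Measurable.tsum fun l => hm' j l),
          lintegral_tsum fun j => (Measurable.tsum fun l => hm' j l).aemeasurable]
        congr 2 with j
        rw [lintegral_tsum fun l => (hm' j l).aemeasurable]
        congr 1 with l
        rw [lintegral_indicator_one (hm j l), hS.measure_inter_sub_mem l (hF j) hB]
    _ = 2 * (green S P A * green S P B) := by
        simp_rw [ENNReal.tsum_mul_left, ENNReal.tsum_mul_right]
        rfl

/-- If at each time `i ≤ p` the walk is in the unit ball with probability at least `1/2`, then,
given that `A` is hit, a neighbourhood of `A` is visited at a multiple of `p` with probability at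
least `1/2`: apply the Markov property at the first visit to `A`. -/
theorem measure_exists_mem_le (hS : IsRandomWalk S P) {A : Set (Fin d → ℝ)}
    (hA : MeasurableSet A) {p : ℕ} (hp : 0 < p)
    (hstay : ∀ i ≤ p, 1 / 2 ≤ P {ω | S i ω ∈ Metric.ball 0 1}) :
    P {ω | ∃ k, S k ω ∈ A} ≤ 2 * ∑' j, P {ω | S (p * j) ω ∈ Metric.thickening 1 A} := by
  have hF := fun j => hS.measurableSet_firstVisit hA j
  have hF' := fun j => hS.stepAlgebra_le _ _ (hF j)
  have hT : MeasurableSet (Metric.thickening 1 A) := Metric.isOpen_thickening.measurableSet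
  have h1 : ∀ k, P (firstVisit S A k) ≤
      2 * ∑' j, P (firstVisit S A k ∩ {ω | S (p * j) ω ∈ Metric.thickening 1 A}) := by
    intro k
    -- the first multiple of `p` from time `k` on
    obtain ⟨j, l, hl, hj⟩ : ∃ j l, l ≤ p ∧ p * j = k + l := by
      refine ⟨k / p + 1, p - k % p, Nat.sub_le _ _, ?_⟩
      have := Nat.div_add_mod k p
      have := Nat.mod_lt k hp
      rw [mul_add, mul_one]
      omega
    calc P (firstVisit S A k) = 2 * (P (firstVisit S A k) * (1 / 2)) := by
          rw [mul_comm (P _), ← mul_assoc, one_div, ENNReal.mul_inv_cancel two_ne_zero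
            ENNReal.ofNat_ne_top, one_mul]
      _ ≤ 2 * (P (firstVisit S A k) * P {ω | S l ω ∈ Metric.ball 0 1}) := by
          gcongr; exact hstay l hl
      _ = 2 * P (firstVisit S A k ∩ {ω | S (k + l) ω - S k ω ∈ Metric.ball 0 1}) := by
          rw [hS.measure_inter_sub_mem l (hF k) measurableSet_ball]
      _ ≤ 2 * P (firstVisit S A k ∩ {ω | S (p * j) ω ∈ Metric.thickening 1 A}) := by
          refine mul_le_mul_right (measure_mono ?_) 2
          rintro ω ⟨h1, h2⟩
          refine ⟨h1, Metric.mem_thickening_iff.2 ⟨S k ω, h1.1, ?_⟩⟩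
          rw [hj, dist_eq_norm]
          simpa using h2
      _ ≤ _ := by
          gcongr
          exact ENNReal.le_tsum (f := fun j =>
            P (firstVisit S A k ∩ {ω | S (p * j) ω ∈ Metric.thickening 1 A})) j
  rw [← hS.tsum_measure_firstVisit hA]
  calc ∑' k, P (firstVisit S A k)
      ≤ ∑' k, 2 * ∑' j, P (firstVisit S A k ∩ {ω | S (p * j) ω ∈ Metric.thickening 1 A}) :=
        ENNReal.tsum_le_tsum h1
    _ = 2 * ∑' j, ∑' k, P (firstVisit S A k ∩ {ω | S (p * j) ω ∈ Metric.thickening 1 A}) := by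
        rw [ENNReal.tsum_mul_left, ENNReal.tsum_comm]
    _ ≤ _ := by
        gcongr with j
        rw [← measure_iUnion]
        · exact measure_mono (iUnion_subset fun k => inter_subset_right)
        · intro i k hik
          exact (firstVisit_disjoint A hik).mono inter_subset_left inter_subset_left
        · exact fun k => (hF' k).inter (hS.measurable _ hT)

end IsRandomWalk

end Walk

/-! ### Occupation times and Green measures of boxes -/

theorem indicator_box_eq_sum {d : ℕ} (n : ℕ) (y : Fin d → ℝ) :
    (halfOpenBox 0 ((2 : ℝ) ^ n)).indicator (1 : (Fin d → ℝ) → ℝ≥0∞) y =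
      ∑ x ∈ boxPts d n, (unitBox (latticePt x)).indicator 1 y := by
  have h : ∀ x : Fin d → ℤ, (unitBox (latticePt x)).indicator (1 : (Fin d → ℝ) → ℝ≥0∞) y =
      if cell y = x then 1 else 0 := fun x => by
    classical
    simp [indicator_apply, mem_unitBox_latticePt]
  have h' : cell y ∈ boxPts d n ↔ y ∈ halfOpenBox 0 ((2 : ℝ) ^ n) :=
    mem_boxPts.trans latticePt_cell_mem_box
  classical
  rw [indicator_apply]
  simp only [h, Finset.sum_ite_eq, Pi.one_apply, if_congr h' rfl rfl]

theorem occupation_box_eq_sum {Ω : Type*} {d : ℕ} (S : ℕ → Ω → Fin d → ℝ) (n : ℕ) (ω : Ω) :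
    occupation S (halfOpenBox 0 (2 ^ n)) ω =
      ∑ x ∈ boxPts d n, occupation S (unitBox (latticePt x)) ω := by
  unfold occupation
  rw [← Summable.tsum_finsetSum fun i _ => ENNReal.summable]
  exact tsum_congr fun k => indicator_box_eq_sum n _

theorem ENNReal.le_add_sq_mul_inv (a : ℝ≥0∞) {c : ℝ≥0} (hc : c ≠ 0) :
    a ≤ c + a ^ 2 * (c⁻¹ : ℝ≥0) := by
  rcases le_total a c with h | h
  · exact h.trans le_self_add
  · refine le_trans ?_ le_add_self
    calc a = a * (c * (c⁻¹ : ℝ≥0)) := by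
          rw [← ENNReal.coe_mul, mul_inv_cancel₀ hc, ENNReal.coe_one, mul_one]
      _ ≤ a * (a * (c⁻¹ : ℝ≥0)) := by gcongr
      _ = _ := by ring

/-- The occupation time of `B(0; 2^n)` is controlled by the number of pixels that the walk visits
there and by the squared occupation times of the single pixels. -/
theorem occupation_box_le {Ω : Type*} {d : ℕ} (S : ℕ → Ω → Fin d → ℝ) (n : ℕ) (ω : Ω)
    {c : ℝ≥0} (hc : c ≠ 0) :
    occupation S (halfOpenBox 0 (2 ^ n)) ω ≤ c * (pixInBox (range fun k => S k ω) n).ncard +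
      (∑ x ∈ boxPts d n, occupation S (unitBox (latticePt x)) ω ^ 2) * (c⁻¹ : ℝ≥0) := by
  classical
  rw [occupation_box_eq_sum, ncard_pixInBox, Finset.card_filter, Finset.sum_mul]
  push_cast
  rw [Finset.mul_sum, ← Finset.sum_add_distrib]
  refine Finset.sum_le_sum fun x _ => ?_
  split_ifs with h
  · rw [mul_one]
    exact ENNReal.le_add_sq_mul_inv _ hc
  · rw [mem_pix_range_iff] at h
    push Not at h
    have : occupation S (unitBox (latticePt x)) ω = 0 := by
      rw [occupation, ENNReal.tsum_eq_zero]
      exact fun k => indicator_of_notMem (h k) _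
    rw [this]
    exact zero_le

section Green

variable {Ω : Type*} [MeasurableSpace Ω] {P : Measure Ω} {d : ℕ} {S : ℕ → Ω → Fin d → ℝ}

theorem green_mono {A B : Set (Fin d → ℝ)} (h : A ⊆ B) : green S P A ≤ green S P B :=
  ENNReal.tsum_le_tsum fun _ => measure_mono fun _ hω => h hω

theorem green_biUnion_le {ι : Type*} (s : Finset ι) (A : ι → Set (Fin d → ℝ)) :
    green S P (⋃ i ∈ s, A i) ≤ ∑ i ∈ s, green S P (A i) := by
  unfold green
  rw [← Summable.tsum_finsetSum fun i _ => ENNReal.summable]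
  refine ENNReal.tsum_le_tsum fun k => ?_
  have : {ω | S k ω ∈ ⋃ i ∈ s, A i} = ⋃ i ∈ s, {ω | S k ω ∈ A i} := by ext; simp
  rw [this]
  exact measure_biUnion_finset_le s _

theorem halfOpenBox_succ_subset (d n : ℕ) :
    halfOpenBox (0 : Fin d → ℝ) (2 ^ (n + 1)) ⊆ ⋃ v ∈ (Finset.univ : Finset (Fin d → Fin 4)),
      {y : Fin d → ℝ | ∀ i, ((v i : ℕ) - 2 : ℝ) * 2 ^ n ≤ y i ∧
        y i < ((v i : ℕ) - 1 : ℝ) * 2 ^ n} := by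
  intro y hy
  rw [mem_halfOpenBox_zero] at hy
  have key : ∀ i, ∃ v : Fin 4, ((v : ℕ) - 2 : ℝ) * 2 ^ n ≤ y i ∧
      y i < ((v : ℕ) - 1 : ℝ) * 2 ^ n := by
    intro i
    have h1 := (hy i).1
    have h2 := (hy i).2
    rw [pow_succ] at h1 h2
    rcases lt_or_ge (y i) (-2 ^ n) with h | h
    · exact ⟨0, by norm_num; constructor <;> linarith⟩
    rcases lt_or_ge (y i) 0 with h' | h'
    · exact ⟨1, by norm_num; constructor <;> linarith⟩
    rcases lt_or_ge (y i) (2 ^ n) with h'' | h''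
    · exact ⟨2, by norm_num; constructor <;> linarith⟩
    · exact ⟨3, by norm_num; constructor <;> linarith⟩
  choose v hv using key
  simp only [Finset.mem_univ, iUnion_true, mem_iUnion]
  exact ⟨v, hv⟩

/-- The Green measure of boxes is doubling: the larger box is covered by `4^d` cubes whose
difference sets lie in the smaller one. -/
theorem IsRandomWalk.green_box_succ_le [IsProbabilityMeasure P] (hS : IsRandomWalk S P) (n : ℕ) :
    green S P (halfOpenBox 0 (2 ^ (n + 1))) ≤ 4 ^ d * green S P (halfOpenBox 0 (2 ^ n)) := by
  refine (green_mono (halfOpenBox_succ_subset d n)).trans ((green_biUnion_le _ _).trans ?_)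
  refine (Finset.sum_le_card_nsmul _ _ (green S P (halfOpenBox 0 (2 ^ n))) fun v _ => ?_).trans ?_
  · refine hS.green_le_of_sub_mem ?_ (measurableSet_halfOpenBox _ _) ?_
    · have : {y : Fin d → ℝ | ∀ i, ((v i : ℕ) - 2 : ℝ) * 2 ^ n ≤ y i ∧
          y i < ((v i : ℕ) - 1 : ℝ) * 2 ^ n} =
          univ.pi fun i => Ico (((v i : ℕ) - 2 : ℝ) * 2 ^ n) (((v i : ℕ) - 1 : ℝ) * 2 ^ n) := by
        ext; simp
      rw [this]
      exact MeasurableSet.univ_pi fun i => measurableSet_Ico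
    · intro a ha a' ha'
      rw [mem_halfOpenBox_zero]
      intro i
      have h1 := ha i
      have h2 := ha' i
      simp only [Pi.sub_apply]
      constructor <;> nlinarith
  · simp

theorem IsRandomWalk.green_box_eq_sum (hS : IsRandomWalk S P) (n : ℕ) :
    green S P (halfOpenBox 0 (2 ^ n)) = ∑ x ∈ boxPts d n, green S P (unitBox (latticePt x)) := by
  rw [← hS.lintegral_occupation (measurableSet_halfOpenBox _ _)]
  simp_rw [occupation_box_eq_sum]
  rw [lintegral_finsetSum _ fun x _ => hS.measurable_occupation (measurableSet_unitBox _)]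
  exact Finset.sum_congr rfl fun x _ => hS.lintegral_occupation (measurableSet_unitBox _)

theorem IsRandomWalk.one_le_green_box [IsProbabilityMeasure P] (hS : IsRandomWalk S P) (n : ℕ) :
    1 ≤ green S P (halfOpenBox 0 (2 ^ n)) := by
  refine le_trans ?_ (ENNReal.le_tsum 0)
  have : {ω | S 0 ω ∈ halfOpenBox 0 ((2 : ℝ) ^ n)} = univ := by
    ext ω
    simp [hS.zero, mem_halfOpenBox_zero]
  rw [this, measure_univ]

/-! ### The range of a random walk has many pixels -/

theorem lintegral_sum_occupation_sq_le (hS : IsRandomWalk S P) (n : ℕ) :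
    ∫⁻ ω, ∑ x ∈ boxPts d n, occupation S (unitBox (latticePt x)) ω ^ 2 ∂P ≤
      2 * (green S P (halfOpenBox 0 (2 ^ n)) * green S P (halfOpenBox 0 (2 ^ 0))) := by
  rw [lintegral_finsetSum _ fun x _ =>
    (hS.measurable_occupation (measurableSet_unitBox _)).pow_const 2]
  rw [hS.green_box_eq_sum n, Finset.sum_mul, Finset.mul_sum]
  refine Finset.sum_le_sum fun x _ => hS.lintegral_occupation_sq_le (measurableSet_unitBox _)
    (measurableSet_halfOpenBox _ _) fun a ha a' ha' => ?_
  rw [mem_halfOpenBox_zero]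
  intro i
  have h1 := ha i
  have h2 := ha' i
  simp only [Pi.sub_apply, pow_zero]
  constructor <;> linarith

/-- A second moment estimate: the number of pixels of the range in `B(0; 2^n)` is, with probability
bounded below, at least a constant times the Green measure of the box. -/
theorem IsRandomWalk.measure_ncard_pixInBox_ge [IsProbabilityMeasure P] (hS : IsRandomWalk S P)
    {n : ℕ} {M g : ℝ≥0} (hM : green S P (halfOpenBox 0 (2 ^ 0)) = M)
    (hg : green S P (halfOpenBox 0 (2 ^ n)) = g) :
    ((32 * 4 ^ d : ℝ≥0)⁻¹ : ℝ≥0) ≤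
      P {ω | (32 * M)⁻¹ * g ≤ ((pixInBox (range fun k => S k ω) n).ncard : ℝ≥0)} := by
  have hM1 : 1 ≤ M := by exact_mod_cast hM ▸ hS.one_le_green_box 0
  have hg1 : 1 ≤ g := by exact_mod_cast hg ▸ hS.one_le_green_box n
  have hM0 : M ≠ 0 := (zero_lt_one.trans_le hM1).ne'
  have hg0 : g ≠ 0 := (zero_lt_one.trans_le hg1).ne'
  set E := {ω | (32 * M)⁻¹ * g ≤ ((pixInBox (range fun k => S k ω) n).ncard : ℝ≥0)}
  have hE : MeasurableSet E := by
    have h1 : Measurable fun ω => ((pixInBox (range fun k => S k ω) n).ncard : ℝ≥0) :=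
      (measurable_of_countable fun N : ℕ => (N : ℝ≥0)).comp
        (measurable_ncard_pixInBox hS.measurable n)
    exact measurableSet_le measurable_const h1
  -- on the complement of `E` there are few pixels and `c = 8 * M` makes the pixel term small;
  -- on `E` the threshold `l` makes the second moment term small
  set c : ℝ≥0 := 8 * M
  set l : ℝ≥0 := 8 * 4 ^ d * g
  have hc : c ≠ 0 := by positivity
  have hl : l ≠ 0 := by positivity
  set L := occupation S (halfOpenBox 0 (2 ^ n))
  set V := fun ω => ∑ x ∈ boxPts d n, occupation S (unitBox (latticePt x)) ω ^ 2
  have hL : Measurable L := hS.measurable_occupation (measurableSet_halfOpenBox _ _)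
  have hV : Measurable V := Finset.measurable_sum _ fun x _ =>
    (hS.measurable_occupation (measurableSet_unitBox _)).pow_const 2
  have hpt : ∀ ω, L ω ≤ ((c * ((32 * M)⁻¹ * g) : ℝ≥0) : ℝ≥0∞) + V ω * (c⁻¹ : ℝ≥0) +
      (l * E.indicator 1 ω + L ω ^ 2 * (l⁻¹ : ℝ≥0)) := by
    intro ω
    by_cases hω : ω ∈ E
    · refine le_trans ?_ le_add_self
      rw [indicator_of_mem hω, Pi.one_apply, mul_one]
      exact ENNReal.le_add_sq_mul_inv _ hl
    · refine le_trans ?_ le_self_add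
      refine (occupation_box_le S n ω hc).trans ?_
      gcongr
      simp only [E, mem_ofPred_eq, not_le] at hω
      rw [ENNReal.coe_mul c]
      gcongr
      rw [← ENNReal.coe_natCast]
      exact ENNReal.coe_le_coe.2 hω.le
  have hint := lintegral_mono (μ := P) hpt
  rw [lintegral_add_left (by fun_prop), lintegral_add_left measurable_const,
    lintegral_add_left ((measurable_one.indicator hE).const_mul _), lintegral_const, measure_univ,
    mul_one, lintegral_mul_const _ hV, lintegral_mul_const _ (hL.pow_const 2),
    lintegral_const_mul _ (measurable_one.indicator hE), lintegral_indicator_one hE,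
    hS.lintegral_occupation (measurableSet_halfOpenBox _ _), hg] at hint
  have hV2 : ∫⁻ ω, V ω ∂P ≤ ((2 * (g * M) : ℝ≥0) : ℝ≥0∞) := by
    refine (lintegral_sum_occupation_sq_le hS n).trans_eq ?_
    rw [hg, hM]; push_cast; rfl
  have hL2 : ∫⁻ ω, L ω ^ 2 ∂P ≤ ((2 * (g * (4 ^ d * g)) : ℝ≥0) : ℝ≥0∞) := by
    refine (hS.lintegral_occupation_sq_le (B := halfOpenBox 0 (2 ^ (n + 1)))
      (measurableSet_halfOpenBox _ _) (measurableSet_halfOpenBox _ _) ?_).trans ?_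
    · intro a ha a' ha'
      rw [mem_halfOpenBox_zero] at *
      intro i
      have h1 := ha i
      have h2 := ha' i
      simp only [Pi.sub_apply, pow_succ]
      constructor <;> linarith
    · push_cast
      rw [hg]
      gcongr
      rw [← hg]
      exact hS.green_box_succ_le n
  have hfin := hint.trans (add_le_add (add_le_add_right (mul_le_mul_left hV2 _) _)
    (add_le_add_right (mul_le_mul_left hL2 _) _))
  obtain ⟨p, hp⟩ : ∃ p : ℝ≥0, P E = p :=
    ⟨(P E).toNNReal, (ENNReal.coe_toNNReal (by finiteness)).symm⟩
  rw [hp] at hfin ⊢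
  norm_cast at hfin ⊢
  rw [inv_le_iff_one_le_mul₀ (by positivity)]
  rw [← NNReal.coe_le_coe] at hfin ⊢
  simp only [c, l] at hfin
  push_cast at hfin ⊢
  have hgR : (0 : ℝ) < g := by exact_mod_cast pos_iff_ne_zero.2 hg0
  have hMR : (0 : ℝ) < M := by exact_mod_cast pos_iff_ne_zero.2 hM0
  have e1 : 8 * (M : ℝ) * ((32 * (M : ℝ))⁻¹ * g) = g / 4 := by field_simp; norm_num
  have e2 : 2 * ((g : ℝ) * M) * (8 * (M : ℝ))⁻¹ = g / 4 := by field_simp; norm_num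
  have e3 : 2 * ((g : ℝ) * (4 ^ d * g)) * (8 * 4 ^ d * (g : ℝ))⁻¹ = g / 4 := by field_simp; norm_num
  rw [e1, e2, e3] at hfin
  have : (g : ℝ) * 1 ≤ g * (p * (32 * 4 ^ d)) := by linarith
  exact le_of_mul_le_mul_left this hgR

/-! ### The zero-one law and the lower bound -/

/-- The dimension of the range does not depend on any finite number of steps. -/
theorem IsRandomWalk.macroMinkowskiDim_range_zero_one (hS : IsRandomWalk S P) (b : EReal) :
    P {ω | b ≤ macroMinkowskiDim (range fun k => S k ω)} = 0 ∨
      P {ω | b ≤ macroMinkowskiDim (range fun k => S k ω)} = 1 := by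
  refine measure_zero_or_one_of_measurableSet_limsup_atTop
    (s := fun i => MeasurableSpace.comap (fun ω => S (i + 1) ω - S i ω) inferInstance)
    (fun i => ((hS.measurable (i + 1)).sub (hS.measurable i)).comap_le) hS.indep ?_
  rw [limsup_eq_iInf_iSup_of_nat, MeasurableSpace.measurableSet_iInf]
  intro m
  have hshift : ∀ ω, macroMinkowskiDim (range fun k => S k ω) =
      macroMinkowskiDim (range fun k => S (m + k) ω - S m ω) := by
    intro ω
    obtain ⟨c, hc⟩ : ∃ c, ∀ k ≤ m, ‖S k ω‖ ≤ c := by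
      obtain ⟨c, hc⟩ := ((Set.finite_Iic m).image fun k => ‖S k ω‖).bddAbove
      exact ⟨c, fun k hk => hc ⟨k, hk, rfl⟩⟩
    refine le_antisymm ?_ ?_
    · refine macroMinkowskiDim_le_of_near (c := c) ?_
      rintro _ ⟨k, rfl⟩
      rcases le_total k m with h | h
      · exact ⟨0, ⟨0, by simp⟩, by simpa using hc k h⟩
      · exact ⟨_, ⟨k - m, rfl⟩, by simpa [Nat.add_sub_cancel' h] using hc m le_rfl⟩
    · refine macroMinkowskiDim_le_of_near (c := c) ?_
      rintro _ ⟨k, rfl⟩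
      exact ⟨_, ⟨m + k, rfl⟩, by simpa using hc m le_rfl⟩
  simp only [hshift]
  have hm : Measurable[stepAlgebra S (Ici m)]
      fun ω => macroMinkowskiDim (range fun k => S (m + k) ω - S m ω) :=
    measurable_macroMinkowskiDim (m := stepAlgebra S (Ici m))
      fun k => measurable_stepAlgebra_sub (Nat.le_add_right m k) fun i hi => hi.1
  exact hm measurableSet_Ici

theorem IsRandomWalk.ae_le_macroMinkowskiDim [IsProbabilityMeasure P] (hS : IsRandomWalk S P)
    (hfin : ∀ n, green S P (halfOpenBox 0 (2 ^ n)) ≠ ∞) {b : ℝ}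
    (hb : ∃ᶠ n : ℕ in atTop, 2 ^ (b * n) ≤ (green S P (halfOpenBox 0 (2 ^ n))).toReal) :
    ∀ᵐ ω ∂P, (b : EReal) ≤ macroMinkowskiDim (range fun k => S k ω) := by
  set g : ℕ → ℝ≥0 := fun n => (green S P (halfOpenBox 0 (2 ^ n))).toNNReal
  have hg : ∀ n, green S P (halfOpenBox 0 (2 ^ n)) = g n :=
    fun n => (ENNReal.coe_toNNReal (hfin n)).symm
  have hm : MeasurableSet {ω | (b : EReal) ≤ macroMinkowskiDim (range fun k => S k ω)} :=
    measurable_macroMinkowskiDim hS.measurable measurableSet_Ici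
  rcases hS.macroMinkowskiDim_range_zero_one b with h0 | h1
  swap
  · exact (prob_compl_eq_zero_iff hm).2 h1
  exfalso
  set E : ℕ → Set Ω := fun n =>
    {ω | (32 * g 0)⁻¹ * g n ≤ ((pixInBox (range fun k => S k ω) n).ncard : ℝ≥0)}
  have hE : ∀ n, MeasurableSet (E n) := by
    intro n
    have h1 : Measurable fun ω => ((pixInBox (range fun k => S k ω) n).ncard : ℝ≥0) :=
      (measurable_of_countable fun N : ℕ => (N : ℝ≥0)).comp
        (measurable_ncard_pixInBox hS.measurable n)
    exact measurableSet_le measurable_const h1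
  set J : Set ℕ := {n | 2 ^ (b * n) ≤ (g n : ℝ)}
  have hg0 : (0 : ℝ) < g 0 := by
    have : 1 ≤ g 0 := by exact_mod_cast hg 0 ▸ hS.one_le_green_box 0
    exact_mod_cast zero_lt_one.trans_le this
  -- if the dimension is a.s. below `b`, the events `E n` with `n ∈ J` a.s. occur finitely often
  have hae : ∀ᵐ ω ∂P, ∀ᶠ n in atTop, ω ∈ {ω | n ∈ J ∧ ω ∈ E n} ↔ ω ∈ (∅ : Set Ω) := by
    have h0' : ∀ᵐ ω ∂P, ¬ (b : EReal) ≤ macroMinkowskiDim (range fun k => S k ω) := by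
      rw [ae_iff]; simpa using! h0
    filter_upwards [h0'] with ω hω
    by_contra hcon
    refine hω (le_macroMinkowskiDim_of_frequently (c := (32 * g 0 : ℝ)⁻¹) (by positivity) ?_)
    refine (not_eventually.1 hcon).mono fun n hn => ?_
    simp only [mem_empty_iff_false, iff_false, not_not] at hn
    have h2 : (((32 * g 0)⁻¹ * g n : ℝ≥0) : ℝ) ≤ (pixInBox (range fun k => S k ω) n).ncard := by
      exact_mod_cast hn.2
    push_cast at h2
    refine le_trans ?_ h2
    gcongr
    exact hn.1
  have hlim := tendsto_measure_of_ae_tendsto_indicator_of_isFiniteMeasure (μ := P) atTop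
    MeasurableSet.empty (fun n => (MeasurableSet.const (n ∈ J)).inter (hE n)) hae
  rw [measure_empty] at hlim
  have hpos : (0 : ℝ≥0∞) < ((32 * 4 ^ d : ℝ≥0)⁻¹ : ℝ≥0) := by
    rw [ENNReal.coe_pos]; positivity
  obtain ⟨n, hn, hnJ⟩ := ((hb.and_eventually (hlim.eventually_lt_const hpos))).exists
  refine absurd hnJ (not_lt.2 ?_)
  have : {ω | n ∈ J} ∩ E n = E n := by
    have : n ∈ J := hn
    simp [this]
  rw [this]
  exact hS.measure_ncard_pixInBox_ge (hg 0) (hg n)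

end Green

/-! ### Skeletons of a Lévy process -/

/-- The process `X - X_0` observed at the multiples of `δ`. Subtracting `X_0`, which vanishes
almost surely, makes the walk start at the origin everywhere. -/
noncomputable def skeleton {Ω : Type*} {d : ℕ} (X : ℝ≥0 → Ω → Fin d → ℝ) (δ : ℝ≥0)
    (k : ℕ) (ω : Ω) : Fin d → ℝ := X (k * δ) ω - X 0 ω

theorem thickening_unitBox_subset {d : ℕ} (x : Fin d → ℤ) :
    Metric.thickening 1 (unitBox (latticePt x)) ⊆
      ⋃ v ∈ Finset.Icc (fun _ => -1 : Fin d → ℤ) (fun _ => 1), unitBox (latticePt (x + v)) := by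
  intro y hy
  obtain ⟨z, hz, hyz⟩ := Metric.mem_thickening_iff.1 hy
  simp only [mem_iUnion]
  refine ⟨cell y - x, ?_, mem_unitBox_latticePt.2 (by simp)⟩
  have key : ∀ i, -1 ≤ ⌊y i⌋ - x i ∧ ⌊y i⌋ - x i ≤ 1 := by
    intro i
    have h1 := abs_lt.1 ((norm_le_pi_norm (y - z) i).trans_lt (dist_eq_norm y z ▸ hyz))
    have h2 := hz i
    simp only [Pi.sub_apply, latticePt] at h1 h2
    have h3 : ((x i - 1 : ℤ) : ℝ) ≤ y i := by push_cast; linarith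
    have h4 : y i < ((x i + 1 + 1 : ℤ) : ℝ) := by push_cast; linarith
    have h5 := Int.le_floor.2 h3
    have h6 := Int.floor_lt.2 h4
    omega
  rw [Finset.mem_Icc]
  exact ⟨fun i => (key i).1, fun i => (key i).2⟩

theorem thickening_box_subset {d : ℕ} (n : ℕ) :
    Metric.thickening 1 (halfOpenBox (0 : Fin d → ℝ) (2 ^ n)) ⊆ halfOpenBox 0 (2 ^ (n + 1)) := by
  intro y hy
  obtain ⟨z, hz, hyz⟩ := Metric.mem_thickening_iff.1 hy
  rw [mem_halfOpenBox_zero] at *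
  intro i
  have h1 := abs_lt.1 ((norm_le_pi_norm (y - z) i).trans_lt (dist_eq_norm y z ▸ hyz))
  have h2 := hz i
  have h3 : (1 : ℝ) ≤ 2 ^ n := one_le_pow₀ one_le_two
  simp only [Pi.sub_apply] at h1
  rw [pow_succ]
  constructor <;> linarith

section Levy

variable {Ω : Type*} [MeasurableSpace Ω] {P : Measure Ω} {d : ℕ}

theorem IsRandomWalk.sum_green_thickening_le {S : ℕ → Ω → Fin d → ℝ} (hS : IsRandomWalk S P)
    (n : ℕ) : ∑ x ∈ boxPts d n, green S P (Metric.thickening 1 (unitBox (latticePt x))) ≤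
      3 ^ d * green S P (halfOpenBox 0 (2 ^ (n + 1))) := by
  set V : Finset (Fin d → ℤ) := Finset.Icc (fun _ => -1) (fun _ => 1)
  have hV : V.card = 3 ^ d := by
    rw [Pi.card_Icc]
    simp
  calc ∑ x ∈ boxPts d n, green S P (Metric.thickening 1 (unitBox (latticePt x)))
      ≤ ∑ x ∈ boxPts d n, ∑ v ∈ V, green S P (unitBox (latticePt (x + v))) :=
        Finset.sum_le_sum fun x _ =>
          (green_mono (thickening_unitBox_subset x)).trans (green_biUnion_le _ _)
    _ = ∑ v ∈ V, ∑ x ∈ boxPts d n, green S P (unitBox (latticePt (x + v))) := Finset.sum_comm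
    _ ≤ ∑ v ∈ V, green S P (halfOpenBox 0 (2 ^ (n + 1))) := by
        refine Finset.sum_le_sum fun v hv => ?_
        rw [hS.green_box_eq_sum]
        calc ∑ x ∈ boxPts d n, green S P (unitBox (latticePt (x + v)))
            = ∑ y ∈ (boxPts d n).map (addRightEmbedding v), green S P (unitBox (latticePt y)) := by
              rw [Finset.sum_map]; rfl
          _ ≤ _ := by
              refine Finset.sum_le_sum_of_subset fun y hy => ?_
              obtain ⟨x, hx, rfl⟩ := Finset.mem_map.1 hy
              rw [mem_boxPts, mem_halfOpenBox_zero] at *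
              intro i
              have h1 := hx i
              have h2 : ((-1 : ℤ) : ℝ) ≤ v i := Int.cast_le.2 ((Finset.mem_Icc.1 hv).1 i)
              have h3 : (v i : ℝ) ≤ (1 : ℤ) := Int.cast_le.2 ((Finset.mem_Icc.1 hv).2 i)
              have h4 : (1 : ℝ) ≤ 2 ^ n := one_le_pow₀ one_le_two
              simp only [latticePt, addRightEmbedding_apply, Pi.add_apply, pow_succ] at *
              push_cast at *
              constructor <;> linarith
    _ = _ := by rw [Finset.sum_const, hV, nsmul_eq_mul]; push_cast; rfl

variable {X : ℝ≥0 → Ω → Fin d → ℝ}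

namespace IsLevyProcess

theorem identDistrib_sub_zero (hX : IsLevyProcess X P) (t : ℝ≥0) :
    IdentDistrib (fun ω => X t ω - X 0 ω) (X t) P P := by
  simpa using hX.stationary 0 t

theorem isRandomWalk_skeleton (hX : IsLevyProcess X P) (δ : ℝ≥0) :
    IsRandomWalk (skeleton X δ) P where
  measurable k := (hX.measurable _).sub (hX.measurable 0)
  zero ω := by simp [skeleton]
  indep := by
    have h := hX.indep.nat (t := fun k : ℕ => (k : ℝ≥0) * δ)
      fun i j hij => by dsimp only; gcongr
    simpa [skeleton] using h
  stationary k l := by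
    have h := (hX.stationary (k * δ) (l * δ)).trans (hX.identDistrib_sub_zero (l * δ)).symm
    simpa [skeleton, add_mul] using! h

/-- Continuity in probability at time zero. -/
theorem exists_pos_forall_half_le [IsProbabilityMeasure P] (hX : IsLevyProcess X P) :
    ∃ h : ℝ≥0, 0 < h ∧ ∀ u ≤ h, 1 / 2 ≤ P {ω | X u ω - X 0 ω ∈ Metric.ball 0 1} := by
  have hm : ∀ u, MeasurableSet {ω | X u ω - X 0 ω ∈ Metric.ball (0 : Fin d → ℝ) 1} :=
    fun u => ((hX.measurable u).sub (hX.measurable 0)) measurableSet_ball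
  have hlim := tendsto_measure_of_ae_tendsto_indicator_of_isFiniteMeasure (μ := P) (𝓝 (0 : ℝ≥0))
    MeasurableSet.univ hm (by
      filter_upwards [hX.cadlag] with ω hω
      have h1 : ContinuousAt (fun t => X t ω) 0 := by
        have h2 := (hω 0).1
        rwa [show Ici (0 : ℝ≥0) = univ from Ici_bot, continuousWithinAt_univ] at h2
      have h3 : Tendsto (fun t => X t ω - X 0 ω) (𝓝 0) (𝓝 (X 0 ω - X 0 ω)) :=
        h1.tendsto.sub_const _
      rw [sub_self] at h3
      filter_upwards [h3 (Metric.ball_mem_nhds 0 one_pos)] with t ht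
      exact iff_of_true ht (mem_univ _))
  rw [measure_univ] at hlim
  have hev := hlim.eventually_const_lt (show (1 / 2 : ℝ≥0∞) < 1 by
    rw [one_div]; exact ENNReal.inv_lt_one.2 ENNReal.one_lt_two)
  obtain ⟨h, hh, hsub⟩ := exists_Ico_subset_of_mem_nhds hev ⟨1, one_pos⟩
  refine ⟨h / 2, half_pos hh, fun u hu => ?_⟩
  exact (hsub ⟨zero_le, hu.trans_lt (NNReal.half_lt_self hh.ne')⟩).le

/-- A process that is in `A` at time `s` is still near `A` at time `t` with probability at least
`1/2`. -/
theorem measure_mem_le_of_le (hX : IsLevyProcess X P) {h : ℝ≥0}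
    (hh : ∀ u ≤ h, 1 / 2 ≤ P {ω | X u ω - X 0 ω ∈ Metric.ball 0 1}) {s t : ℝ≥0} (hst : s ≤ t)
    (hts : t ≤ s + h) {A : Set (Fin d → ℝ)} (hA : MeasurableSet A) :
    P {ω | X s ω - X 0 ω ∈ A} ≤ 2 * P {ω | X t ω - X 0 ω ∈ Metric.thickening 1 A} := by
  obtain ⟨u, rfl⟩ := exists_add_of_le hst
  have hu : u ≤ h := le_of_add_le_add_left hts
  have hind := (hX.indep.indepFun_sub_sub (zero_le (a := s)) hst).measure_inter_preimage_eq_mul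
    A (Metric.ball 0 1) hA measurableSet_ball
  have hid : P ((X (s + u) - X s) ⁻¹' Metric.ball 0 1) =
      P {ω | X u ω - X 0 ω ∈ Metric.ball 0 1} :=
    ((hX.stationary s u).trans (hX.identDistrib_sub_zero u).symm).measure_mem_eq measurableSet_ball
  calc P {ω | X s ω - X 0 ω ∈ A} = 2 * (P {ω | X s ω - X 0 ω ∈ A} * (1 / 2)) := by
        rw [mul_comm (P _), ← mul_assoc, one_div, ENNReal.mul_inv_cancel two_ne_zero
          ENNReal.ofNat_ne_top, one_mul]
    _ ≤ 2 * (P {ω | X s ω - X 0 ω ∈ A} * P ((X (s + u) - X s) ⁻¹' Metric.ball 0 1)) := by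
        rw [hid]; gcongr; exact hh u hu
    _ = 2 * P ((X s - X 0) ⁻¹' A ∩ (X (s + u) - X s) ⁻¹' Metric.ball 0 1) := by
        rw [hind]; rfl
    _ ≤ _ := by
        refine mul_le_mul_right (measure_mono ?_) 2
        rintro ω ⟨h1, h2⟩
        refine Metric.mem_thickening_iff.2 ⟨X s ω - X 0 ω, h1, ?_⟩
        rw [dist_eq_norm]
        simpa using h2

/-! ### Potential measure against Green measure -/

theorem iUnion_Ico_nat_mul {h : ℝ} (hh : 0 < h) :
    ⋃ k : ℕ, Ico (k * h) ((k + 1) * h) = Ici (0 : ℝ) := by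
  ext t
  simp only [mem_iUnion, mem_Ico, mem_Ici]
  constructor
  · rintro ⟨k, hk, -⟩
    exact le_trans (by positivity) hk
  · intro ht
    refine ⟨⌊t / h⌋₊, ?_, ?_⟩
    · rw [← le_div_iff₀ hh]; exact Nat.floor_le (by positivity)
    · rw [← div_lt_iff₀ hh]; exact Nat.lt_floor_add_one _

theorem lintegral_Ici_eq_tsum {h : ℝ} (hh : 0 < h) (f : ℝ → ℝ≥0∞) :
    ∫⁻ t in Ici 0, f t = ∑' k : ℕ, ∫⁻ t in Ico (k * h) ((k + 1) * h), f t := by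
  rw [← iUnion_Ico_nat_mul hh, lintegral_iUnion fun k => measurableSet_Ico]
  have hmono : Monotone fun k : ℕ => (k : ℝ) * h := fun i j hij => by dsimp only; gcongr
  simpa [Function.onFun] using! hmono.pairwise_disjoint_on_Ico_succ

theorem potentialMeasure_le_green [IsProbabilityMeasure P] (hX : IsLevyProcess X P) {h : ℝ≥0}
    (h0 : 0 < h) (hh : ∀ u ≤ h, 1 / 2 ≤ P {ω | X u ω - X 0 ω ∈ Metric.ball 0 1})
    {A : Set (Fin d → ℝ)} (hA : MeasurableSet A) :
    potentialMeasure X P A ≤ 2 * h * green (skeleton X h) P (Metric.thickening 1 A) := by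
  rw [hX.potentialMeasure_apply hA, lintegral_Ici_eq_tsum (NNReal.coe_pos.2 h0)]
  have hk : ∀ k : ℕ, ∫⁻ t in Ico (k * h : ℝ) ((k + 1) * h), P {ω | X t.toNNReal ω ∈ A} ≤
      2 * h * P {ω | skeleton X h (k + 1) ω ∈ Metric.thickening 1 A} := by
    intro k
    calc ∫⁻ t in Ico (k * h : ℝ) ((k + 1) * h), P {ω | X t.toNNReal ω ∈ A}
        ≤ ∫⁻ t in Ico (k * h : ℝ) ((k + 1) * h),
          2 * P {ω | skeleton X h (k + 1) ω ∈ Metric.thickening 1 A} := by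
          refine setLIntegral_mono' measurableSet_Ico fun t ht => ?_
          have e : P {ω | X t.toNNReal ω ∈ A} = P {ω | X t.toNNReal ω - X 0 ω ∈ A} :=
            ((hX.identDistrib_sub_zero t.toNNReal).measure_mem_eq hA).symm
          rw [e]
          refine hX.measure_mem_le_of_le hh ?_ ?_ hA
          · rw [Real.toNNReal_le_iff_le_coe]; push_cast; exact ht.2.le
          · rw [← NNReal.coe_le_coe, NNReal.coe_add,
              Real.coe_toNNReal _ (le_trans (by positivity) ht.1)]
            push_cast
            linarith [ht.1]
      _ = _ := by
          rw [setLIntegral_const, Real.volume_Ico]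
          have : ((k : ℝ) + 1) * h - k * h = h := by ring
          rw [this, ENNReal.ofReal_coe_nnreal]
          ring
  refine (ENNReal.tsum_le_tsum hk).trans ?_
  rw [ENNReal.tsum_mul_left]
  gcongr
  exact ENNReal.tsum_comp_le_tsum_of_injective (Nat.succ_injective)
    fun k => P {ω | skeleton X h k ω ∈ Metric.thickening 1 A}

theorem green_le_potentialMeasure [IsProbabilityMeasure P] (hX : IsLevyProcess X P) {h : ℝ≥0}
    (h0 : 0 < h) (hh : ∀ u ≤ h, 1 / 2 ≤ P {ω | X u ω - X 0 ω ∈ Metric.ball 0 1})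
    {A : Set (Fin d → ℝ)} (hA : MeasurableSet A) :
    h * green (skeleton X h) P A ≤ 2 * potentialMeasure X P (Metric.thickening 1 A) := by
  have hT : MeasurableSet (Metric.thickening 1 A) := Metric.isOpen_thickening.measurableSet
  rw [hX.potentialMeasure_apply hT, lintegral_Ici_eq_tsum (NNReal.coe_pos.2 h0), green,
    ← ENNReal.tsum_mul_left, ← ENNReal.tsum_mul_left]
  refine ENNReal.tsum_le_tsum fun k => ?_
  have h2 : (h : ℝ≥0∞) * P {ω | skeleton X h k ω ∈ A} =
      ∫⁻ t in Ico (k * h : ℝ) ((k + 1) * h), P {ω | skeleton X h k ω ∈ A} := by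
    rw [setLIntegral_const, Real.volume_Ico]
    have : ((k : ℝ) + 1) * h - k * h = h := by ring
    rw [this, ENNReal.ofReal_coe_nnreal, mul_comm]
  rw [h2, ← lintegral_const_mul' _ _ ENNReal.ofNat_ne_top]
  refine setLIntegral_mono' measurableSet_Ico fun t ht => ?_
  have e : P {ω | X t.toNNReal ω ∈ Metric.thickening 1 A} =
      P {ω | X t.toNNReal ω - X 0 ω ∈ Metric.thickening 1 A} :=
    ((hX.identDistrib_sub_zero t.toNNReal).measure_mem_eq hT).symm
  rw [e]
  refine hX.measure_mem_le_of_le hh ?_ ?_ hA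
  · rw [← NNReal.coe_le_coe, Real.coe_toNNReal _ (le_trans (by positivity) ht.1)]
    push_cast
    exact ht.1
  · rw [Real.toNNReal_le_iff_le_coe]
    push_cast
    linarith [ht.2]

/-! ### Dyadic skeletons and the upper bound -/

/-- The bound for a single refinement does not depend on its mesh, and the refinements increase, so
it passes to their union. -/
theorem measure_exists_dyadic_mem_le [IsProbabilityMeasure P] (hX : IsLevyProcess X P) {h : ℝ≥0}
    (hh : ∀ u ≤ h, 1 / 2 ≤ P {ω | X u ω - X 0 ω ∈ Metric.ball 0 1})
    {A : Set (Fin d → ℝ)} (hA : MeasurableSet A) :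
    P {ω | ∃ q : ℕ × ℕ, skeleton X (h / 2 ^ q.1) q.2 ω ∈ A} ≤
      2 * green (skeleton X h) P (Metric.thickening 1 A) := by
  have hU : {ω | ∃ q : ℕ × ℕ, skeleton X (h / 2 ^ q.1) q.2 ω ∈ A} =
      ⋃ m, {ω | ∃ k, skeleton X (h / 2 ^ m) k ω ∈ A} := by
    ext ω; simp
  have hmono : Monotone fun m => {ω | ∃ k, skeleton X (h / 2 ^ m) k ω ∈ A} := by
    refine monotone_nat_of_le_succ fun m => ?_
    rintro ω ⟨k, hk⟩
    refine ⟨2 * k, ?_⟩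
    have : ((2 * k : ℕ) : ℝ≥0) * (h / 2 ^ (m + 1)) = k * (h / 2 ^ m) := by
      push_cast; rw [pow_succ]; field_simp
    simpa only [skeleton, this] using hk
  rw [hU, hmono.measure_iUnion]
  refine iSup_le fun m => ?_
  refine ((hX.isRandomWalk_skeleton (h / 2 ^ m)).measure_exists_mem_le hA (p := 2 ^ m)
    (by positivity) fun i hi => hh _ ?_).trans_eq ?_
  · calc (i : ℝ≥0) * (h / 2 ^ m) ≤ (2 ^ m : ℕ) * (h / 2 ^ m) := by gcongr
      _ = h := by push_cast; field_simp
  · congr 2 with j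
    have : ((2 ^ m * j : ℕ) : ℝ≥0) * (h / 2 ^ m) = j * h := by push_cast; field_simp
    simp only [skeleton, this]

theorem lintegral_ncard_dyadic_le [IsProbabilityMeasure P] (hX : IsLevyProcess X P) {h : ℝ≥0}
    (hh : ∀ u ≤ h, 1 / 2 ≤ P {ω | X u ω - X 0 ω ∈ Metric.ball 0 1}) (n : ℕ) :
    ∫⁻ ω, (pixInBox (range fun q : ℕ × ℕ => skeleton X (h / 2 ^ q.1) q.2 ω) n).ncard ∂P ≤
      2 * 3 ^ d * green (skeleton X h) P (halfOpenBox 0 (2 ^ (n + 1))) := by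
  classical
  have hm : ∀ q : ℕ × ℕ, Measurable (skeleton X (h / 2 ^ q.1) q.2) :=
    fun q => (hX.isRandomWalk_skeleton _).measurable _
  simp only [ncard_pixInBox, Finset.card_filter]
  push_cast
  rw [lintegral_finsetSum _ fun x _ =>
    Measurable.ite (measurableSet_mem_pix hm x) measurable_const measurable_const]
  calc _ ≤ ∑ x ∈ boxPts d n,
        2 * green (skeleton X h) P (Metric.thickening 1 (unitBox (latticePt x))) := by
        refine Finset.sum_le_sum fun x _ => ?_
        refine le_trans (le_of_eq ?_)
          (hX.measure_exists_dyadic_mem_le hh (measurableSet_unitBox (latticePt x)))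
        have e : {ω | ∃ q : ℕ × ℕ, skeleton X (h / 2 ^ q.1) q.2 ω ∈ unitBox (latticePt x)} =
            {ω | x ∈ pix (range fun q : ℕ × ℕ => skeleton X (h / 2 ^ q.1) q.2 ω)} := by
          ext ω; exact (mem_pix_range_iff _ x).symm
        rw [e, ← lintegral_indicator_one (measurableSet_mem_pix hm x)]
        refine lintegral_congr fun ω => ?_
        simp [indicator_apply]
    _ ≤ _ := by
        rw [← Finset.mul_sum, mul_assoc]
        gcongr
        exact (hX.isRandomWalk_skeleton h).sum_green_thickening_le n

end IsLevyProcess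

/-- Borel–Cantelli: a bound on the expected number of pixels bounds the dimension. -/
theorem ae_macroMinkowskiDim_le_of_lintegral_le {F : Ω → Set (Fin d → ℝ)}
    (hF : ∀ n, Measurable fun ω => (pixInBox (F ω) n).ncard) {a b C : ℝ} (hb : 0 ≤ b) (hab : a < b)
    (h : ∀ n : ℕ, ∫⁻ ω, (pixInBox (F ω) n).ncard ∂P ≤ ENNReal.ofReal (C * 2 ^ (a * n))) :
    ∀ᵐ ω ∂P, macroMinkowskiDim (F ω) ≤ b := by
  have hsum : Summable fun n : ℕ => C * ((2 : ℝ) ^ (a - b)) ^ n :=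
    (summable_geometric_of_lt_one (by positivity)
      (Real.rpow_lt_one_of_one_lt_of_neg one_lt_two (by linarith))).mul_left C
  have hP : ∀ n : ℕ, P {ω | ENNReal.ofReal (2 ^ (b * n)) ≤ (pixInBox (F ω) n).ncard} ≤
      ENNReal.ofReal (C * ((2 : ℝ) ^ (a - b)) ^ n) := by
    intro n
    have hpos : (0 : ℝ) < 2 ^ (b * n) := by positivity
    refine (meas_ge_le_lintegral_div
      (((measurable_of_countable fun N : ℕ => (N : ℝ≥0∞)).comp (hF n)).aemeasurable)
      (ENNReal.ofReal_pos.2 hpos).ne' ENNReal.ofReal_ne_top).trans ?_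
    refine (ENNReal.div_le_div_right (h n) _).trans_eq ?_
    rw [← ENNReal.ofReal_div_of_pos hpos, mul_div_assoc, ← Real.rpow_sub two_pos,
      ← Real.rpow_natCast, ← Real.rpow_mul two_pos.le]
    congr 3
    ring
  have hne : ∑' n : ℕ, P {ω | ENNReal.ofReal (2 ^ (b * n)) ≤ (pixInBox (F ω) n).ncard} ≠ ∞ :=
    ne_top_of_le_ne_top hsum.tsum_ofReal_ne_top (ENNReal.tsum_le_tsum hP)
  filter_upwards [ae_eventually_notMem hne] with ω hω
  refine macroMinkowskiDim_le_of_eventually (C := 1) hb ?_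
  filter_upwards [hω] with n hn
  simp only [not_le] at hn
  rw [one_mul]
  have h2 := (ENNReal.lt_ofReal_iff_toReal_lt (ENNReal.natCast_ne_top _)).1 hn
  simpa using h2.le

end Levy

/-! ### The integral test in terms of the masses of boxes -/

theorem norm_le_of_mem_box {d : ℕ} {x : Fin d → ℝ} {r : ℝ} (hr : 0 ≤ r)
    (hx : x ∈ halfOpenBox 0 r) : ‖x‖ ≤ r := by
  rw [mem_halfOpenBox_zero] at hx
  exact (pi_norm_le_iff_of_nonneg hr).2 fun i => abs_le.2 ⟨(hx i).1, (hx i).2.le⟩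

theorem le_norm_of_notMem_box {d : ℕ} {x : Fin d → ℝ} {r : ℝ}
    (hx : x ∉ halfOpenBox 0 r) : r ≤ ‖x‖ := by
  contrapose! hx
  rw [mem_halfOpenBox_zero]
  intro i
  have h := abs_lt.1 ((norm_le_pi_norm x i).trans_lt hx)
  exact ⟨h.1.le, h.2⟩

theorem measure_box_le_of_lintegral {d : ℕ} (U : Measure (Fin d → ℝ)) {α : ℝ} (hα : 0 < α)
    (n : ℕ) : U (halfOpenBox 0 (2 ^ n)) ≤
      ENNReal.ofReal (2 * 2 ^ (α * n)) * ∫⁻ x, ENNReal.ofReal (1 / (1 + ‖x‖ ^ α)) ∂U := by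
  have hm := measurableSet_halfOpenBox (0 : Fin d → ℝ) (2 ^ n)
  have h1 : (1 : ℝ) ≤ 2 ^ (α * n) := Real.one_le_rpow one_le_two (by positivity)
  rw [← lintegral_const_mul' _ _ ENNReal.ofReal_ne_top, ← lintegral_indicator_one hm]
  refine lintegral_mono (indicator_le fun x hx => ?_)
  rw [Pi.one_apply, ← ENNReal.ofReal_mul (by positivity), ENNReal.one_le_ofReal, mul_one_div,
    le_div_iff₀ (by positivity)]
  have h2 : ‖x‖ ^ α ≤ 2 ^ (α * n) := by
    rw [mul_comm, Real.rpow_mul two_pos.le, Real.rpow_natCast]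
    exact Real.rpow_le_rpow (norm_nonneg x) (norm_le_of_mem_box (by positivity) hx) hα.le
  linarith

/-- The kernel is dominated by a sum over boxes: at `x` use the smallest box that contains it. -/
theorem ofReal_one_div_le_tsum {d : ℕ} {α : ℝ} (hα : 0 < α) (x : Fin d → ℝ) :
    ENNReal.ofReal (1 / (1 + ‖x‖ ^ α)) ≤ ∑' n : ℕ, ENNReal.ofReal (2 ^ α * 2 ^ (-(α * n))) *
      (halfOpenBox 0 (2 ^ n)).indicator 1 x := by
  classical
  have hex : ∃ n : ℕ, x ∈ halfOpenBox 0 ((2 : ℝ) ^ n) := by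
    obtain ⟨n, hn⟩ := pow_unbounded_of_one_lt ‖x‖ one_lt_two
    exact ⟨n, by_contra fun h => not_le.2 hn (le_norm_of_notMem_box h)⟩
  refine le_trans ?_ (ENNReal.le_tsum (Nat.find hex))
  rw [indicator_of_mem (Nat.find_spec hex), Pi.one_apply, mul_one]
  refine ENNReal.ofReal_le_ofReal ?_
  rw [div_le_iff₀ (by positivity)]
  rcases Nat.eq_zero_or_pos (Nat.find hex) with h0 | hpos
  · rw [h0]
    have h1 : (1 : ℝ) ≤ 2 ^ α := Real.one_le_rpow one_le_two hα.le
    have h2 : 0 ≤ ‖x‖ ^ α := by positivity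
    simp only [Nat.cast_zero, mul_zero, neg_zero, Real.rpow_zero, mul_one]
    nlinarith
  · obtain ⟨m, hm⟩ := Nat.exists_eq_succ_of_ne_zero hpos.ne'
    have hnot : x ∉ halfOpenBox 0 ((2 : ℝ) ^ m) := Nat.find_min hex (by omega)
    have h1 : (2 : ℝ) ^ (α * m) ≤ ‖x‖ ^ α := by
      rw [mul_comm, Real.rpow_mul two_pos.le, Real.rpow_natCast]
      exact Real.rpow_le_rpow (by positivity) (le_norm_of_notMem_box hnot) hα.le
    have h2 : (2 : ℝ) ^ α * 2 ^ (-(α * (Nat.find hex : ℕ))) * 2 ^ (α * m) = 1 := by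
      rw [hm, ← Real.rpow_add two_pos, ← Real.rpow_add two_pos]
      push_cast
      ring_nf
      exact Real.rpow_zero 2
    calc (1 : ℝ) = 2 ^ α * 2 ^ (-(α * (Nat.find hex : ℕ))) * 2 ^ (α * m) := h2.symm
      _ ≤ _ := by gcongr; linarith

theorem lintegral_lt_top_of_eventually {d : ℕ} {U : Measure (Fin d → ℝ)}
    (hU : ∀ n : ℕ, U (halfOpenBox 0 (2 ^ n)) ≠ ∞) {a α C : ℝ} (hα : 0 < α) (ha : a < α)
    (h : ∀ᶠ n : ℕ in atTop, (U (halfOpenBox 0 (2 ^ n))).toReal ≤ C * 2 ^ (a * n)) :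
    ∫⁻ x, ENNReal.ofReal (1 / (1 + ‖x‖ ^ α)) ∂U < ∞ := by
  have hm := fun n : ℕ => measurableSet_halfOpenBox (0 : Fin d → ℝ) (2 ^ n)
  have hsum : Summable fun n : ℕ =>
      2 ^ α * 2 ^ (-(α * n)) * (U (halfOpenBox 0 (2 ^ n))).toReal := by
    have hg : Summable fun n : ℕ => 2 ^ α * C * ((2 : ℝ) ^ (a - α)) ^ n :=
      (summable_geometric_of_lt_one (by positivity)
        (Real.rpow_lt_one_of_one_lt_of_neg one_lt_two (by linarith))).mul_left _
    refine hg.of_norm_bounded_eventually_nat ?_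
    filter_upwards [h] with n hn
    rw [Real.norm_of_nonneg (by positivity)]
    calc (2 : ℝ) ^ α * 2 ^ (-(α * n)) * (U (halfOpenBox 0 (2 ^ n))).toReal
        ≤ 2 ^ α * 2 ^ (-(α * n)) * (C * 2 ^ (a * n)) := by gcongr
      _ = 2 ^ α * C * (2 ^ (-(α * n)) * 2 ^ (a * n)) := by ring
      _ = _ := by
        rw [← Real.rpow_add two_pos, ← Real.rpow_natCast, ← Real.rpow_mul two_pos.le]
        congr 2
        ring
  refine lt_of_le_of_lt (lintegral_mono (ofReal_one_div_le_tsum hα)) ?_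
  rw [lintegral_tsum fun n => ((measurable_one.indicator (hm n)).const_mul _).aemeasurable]
  refine lt_of_le_of_lt (ENNReal.tsum_le_tsum fun n => ?_) hsum.tsum_ofReal_ne_top.lt_top
  rw [lintegral_const_mul _ (measurable_one.indicator (hm n)), lintegral_indicator_one (hm n),
    ENNReal.ofReal_mul (by positivity) (q := (U _).toReal), ENNReal.ofReal_toReal (hU n)]

theorem IsTransient.potentialMeasure_box_ne_top {Ω : Type*} [MeasurableSpace Ω] {P : Measure Ω}
    {d : ℕ} {X : ℝ≥0 → Ω → Fin d → ℝ} (hT : IsTransient X P) (n : ℕ) :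
    potentialMeasure X P (halfOpenBox 0 (2 ^ n)) ≠ ∞ := by
  refine ne_top_of_le_ne_top (hT _ (isCompact_closedBall 0 (2 ^ n))).ne (measure_mono fun x hx => ?_)
  simpa using norm_le_of_mem_box (by positivity) hx

/-! ### Paths -/

theorem macroMinkowskiDim_skeleton_le {Ω : Type*} {d : ℕ} (X : ℝ≥0 → Ω → Fin d → ℝ) (h : ℝ≥0)
    (ω : Ω) : macroMinkowskiDim (range fun k => skeleton X h k ω) ≤
      macroMinkowskiDim (processRange X ω) := by
  refine macroMinkowskiDim_le_of_near (c := ‖X 0 ω‖) ?_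
  rintro _ ⟨k, rfl⟩
  exact ⟨_, ⟨k * h, rfl⟩, by simp [skeleton]⟩

/-- By right-continuity, the dyadic refinements of a skeleton come close to every point of the
range. -/
theorem macroMinkowskiDim_processRange_le_dyadic {Ω : Type*} {d : ℕ} {X : ℝ≥0 → Ω → Fin d → ℝ}
    {h : ℝ≥0} (h0 : 0 < h) {ω : Ω} (hω : IsCadlag fun t => X t ω) :
    macroMinkowskiDim (processRange X ω) ≤
      macroMinkowskiDim (range fun q : ℕ × ℕ => skeleton X (h / 2 ^ q.1) q.2 ω) := by
  refine macroMinkowskiDim_le_of_near (c := 1 + ‖X 0 ω‖) ?_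
  rintro _ ⟨t, rfl⟩
  obtain ⟨u, hu, hsub⟩ := mem_nhdsGE_iff_exists_Ico_subset.1
    ((hω t).1.tendsto (Metric.ball_mem_nhds _ one_pos))
  -- a dyadic multiple of `h` in `[t, u)`
  obtain ⟨m, hm⟩ := exists_pow_lt_of_lt_one (div_pos (tsub_pos_of_lt hu) h0)
    (show (1 / 2 : ℝ≥0) < 1 from NNReal.half_lt_self one_ne_zero)
  have hδ : 0 < h / 2 ^ m := by positivity
  have hmem : ((⌈t / (h / 2 ^ m)⌉₊ : ℕ) : ℝ≥0) * (h / 2 ^ m) ∈ Ico t u := by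
    constructor
    · rw [← div_le_iff₀ hδ]
      exact Nat.le_ceil _
    · have h1 := Nat.ceil_lt_add_one (zero_le (a := t / (h / 2 ^ m)))
      rw [lt_div_iff₀ h0, div_pow, one_pow, one_div_mul_eq_div] at hm
      calc ((⌈t / (h / 2 ^ m)⌉₊ : ℕ) : ℝ≥0) * (h / 2 ^ m)
          < (t / (h / 2 ^ m) + 1) * (h / 2 ^ m) := by gcongr
        _ = t + h / 2 ^ m := by rw [add_mul, one_mul, div_mul_cancel₀ _ hδ.ne']
        _ < t + (u - t) := by gcongr
        _ = u := add_tsub_cancel_of_le (le_of_lt hu)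
  refine ⟨_, ⟨(m, ⌈t / (h / 2 ^ m)⌉₊), rfl⟩, ?_⟩
  have h2 := hsub hmem
  rw [mem_preimage, Metric.mem_ball, dist_comm, dist_eq_norm] at h2
  calc ‖X t ω - skeleton X (h / 2 ^ m) ⌈t / (h / 2 ^ m)⌉₊ ω‖
      = ‖(X t ω - X (⌈t / (h / 2 ^ m)⌉₊ * (h / 2 ^ m)) ω) + X 0 ω‖ := by
        rw [skeleton]; congr 1; abel
    _ ≤ _ := (norm_add_le _ _).trans (by gcongr)

/-! ### The two bounds -/

namespace IsLevyProcess

variable {Ω : Type*} [MeasurableSpace Ω] {P : Measure Ω} [IsProbabilityMeasure P] {d : ℕ}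
  {X : ℝ≥0 → Ω → Fin d → ℝ}

theorem green_box_le_potentialMeasure (hX : IsLevyProcess X P) {h : ℝ≥0} (h0 : 0 < h)
    (hh : ∀ u ≤ h, 1 / 2 ≤ P {ω | X u ω - X 0 ω ∈ Metric.ball 0 1}) (n : ℕ) :
    green (skeleton X h) P (halfOpenBox 0 (2 ^ n)) ≤
      ((2 / h : ℝ≥0) : ℝ≥0∞) * potentialMeasure X P (halfOpenBox 0 (2 ^ (n + 1))) := by
  have h1 := (hX.green_le_potentialMeasure h0 hh (measurableSet_halfOpenBox 0 (2 ^ n))).trans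
    (mul_le_mul_right (measure_mono (thickening_box_subset n)) 2)
  have h2 : (h : ℝ≥0∞) ≠ 0 := by exact_mod_cast h0.ne'
  calc green (skeleton X h) P (halfOpenBox 0 (2 ^ n))
      = (h : ℝ≥0∞)⁻¹ * (h * green (skeleton X h) P (halfOpenBox 0 (2 ^ n))) := by
        rw [← mul_assoc, ENNReal.inv_mul_cancel h2 ENNReal.coe_ne_top, one_mul]
    _ ≤ (h : ℝ≥0∞)⁻¹ * (2 * potentialMeasure X P (halfOpenBox 0 (2 ^ (n + 1)))) := by gcongr
    _ = _ := by
        rw [ENNReal.coe_div h0.ne', ENNReal.div_eq_inv_mul, mul_assoc]; rfl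

theorem ae_macroMinkowskiDim_le (hX : IsLevyProcess X P) {α b : ℝ} (hα : 0 < α) (hb : α < b)
    (hint : ∫⁻ x, ENNReal.ofReal (1 / (1 + ‖x‖ ^ α)) ∂(potentialMeasure X P) < ∞) :
    ∀ᵐ ω ∂P, macroMinkowskiDim (processRange X ω) ≤ b := by
  obtain ⟨h, h0, hh⟩ := hX.exists_pos_forall_half_le
  set I := ∫⁻ x, ENNReal.ofReal (1 / (1 + ‖x‖ ^ α)) ∂(potentialMeasure X P)
  have hm : ∀ q : ℕ × ℕ, Measurable (skeleton X (h / 2 ^ q.1) q.2) :=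
    fun q => (hX.isRandomWalk_skeleton _).measurable _
  have hdim := ae_macroMinkowskiDim_le_of_lintegral_le (P := P)
    (F := fun ω => range fun q : ℕ × ℕ => skeleton X (h / 2 ^ q.1) q.2 ω)
    (C := 2 * 3 ^ d * (2 / h) * 2 * 2 ^ (2 * α) * I.toReal)
    (fun n => measurable_ncard_pixInBox hm n) (hα.trans hb).le hb (fun n => by
      calc _ ≤ 2 * 3 ^ d * green (skeleton X h) P (halfOpenBox 0 (2 ^ (n + 1))) :=
            hX.lintegral_ncard_dyadic_le hh n
        _ ≤ 2 * 3 ^ d * (((2 / h : ℝ≥0) : ℝ≥0∞) *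
              (ENNReal.ofReal (2 * 2 ^ (α * (n + 1 + 1 : ℕ))) * I)) := by
            gcongr
            exact (hX.green_box_le_potentialMeasure h0 hh (n + 1)).trans
              (mul_le_mul_right (measure_box_le_of_lintegral _ hα (n + 1 + 1)) _)
        _ = ENNReal.ofReal (2 * 3 ^ d) * (ENNReal.ofReal (2 / h) *
              (ENNReal.ofReal (2 * 2 ^ (α * (n + 1 + 1 : ℕ))) * ENNReal.ofReal I.toReal)) := by
            rw [ENNReal.ofReal_toReal hint.ne]
            congr 2
            · rw [ENNReal.ofReal_mul two_pos.le, ENNReal.ofReal_pow (by norm_num)]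
              norm_num
            · rw [← ENNReal.ofReal_coe_nnreal]; push_cast; rfl
        _ = _ := by
            rw [← ENNReal.ofReal_mul (by positivity), ← ENNReal.ofReal_mul (by positivity),
              ← ENNReal.ofReal_mul (by positivity)]
            congr 1
            have : (2 : ℝ) ^ (α * (n + 1 + 1 : ℕ)) = 2 ^ (2 * α) * 2 ^ (α * n) := by
              rw [← Real.rpow_add two_pos]; push_cast; ring_nf
            rw [this]
            ring)
  filter_upwards [hdim, hX.cadlag] with ω h1 h2
  exact (macroMinkowskiDim_processRange_le_dyadic h0 h2).trans h1

theorem ae_le_macroMinkowskiDim (hX : IsLevyProcess X P) (hT : IsTransient X P) {α b : ℝ}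
    (hα : 0 < α) (hb : b < α)
    (hint : ∫⁻ x, ENNReal.ofReal (1 / (1 + ‖x‖ ^ α)) ∂(potentialMeasure X P) = ∞) :
    ∀ᵐ ω ∂P, b ≤ macroMinkowskiDim (processRange X ω) := by
  obtain ⟨h, h0, hh⟩ := hX.exists_pos_forall_half_le
  have hfin : ∀ n, green (skeleton X h) P (halfOpenBox 0 (2 ^ n)) ≠ ∞ := fun n =>
    ne_top_of_le_ne_top (ENNReal.mul_ne_top ENNReal.coe_ne_top
      (hT.potentialMeasure_box_ne_top (n + 1))) (hX.green_box_le_potentialMeasure h0 hh n)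
  have hfreq : ∃ᶠ n : ℕ in atTop,
      2 ^ (b * n) ≤ (green (skeleton X h) P (halfOpenBox 0 (2 ^ n))).toReal := by
    by_contra hcon
    refine hint.not_lt (lintegral_lt_top_of_eventually (C := 2 * h * 2 ^ b)
      hT.potentialMeasure_box_ne_top hα hb ?_)
    filter_upwards [(tendsto_add_atTop_nat 1).eventually (not_frequently.1 hcon)] with n hn
    have h1 := (hX.potentialMeasure_le_green h0 hh (measurableSet_halfOpenBox 0 (2 ^ n))).trans
      (mul_le_mul_right (green_mono (thickening_box_subset n)) _)
    have h2 := ENNReal.toReal_mono (ENNReal.mul_ne_top (by finiteness) (hfin (n + 1))) h1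
    rw [ENNReal.toReal_mul, ENNReal.toReal_mul] at h2
    refine h2.trans ?_
    have h3 : (2 : ℝ) * h * 2 ^ b * 2 ^ (b * n) = 2 * h * 2 ^ (b * (n + 1 : ℕ)) := by
      rw [mul_assoc _ ((2 : ℝ) ^ b), ← Real.rpow_add two_pos]; push_cast; ring_nf
    rw [h3, ENNReal.toReal_ofNat, ENNReal.coe_toReal]
    gcongr
    exact (not_le.1 hn).le
  filter_upwards [(hX.isRandomWalk_skeleton h).ae_le_macroMinkowskiDim hfin hfreq] with ω hω
  exact hω.trans (macroMinkowskiDim_skeleton_le X h ω)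

end IsLevyProcess

theorem mainTheorem1 {Ω : Type*} [MeasurableSpace Ω] (P : Measure Ω) [IsProbabilityMeasure P]
    (d : ℕ) (X : ℝ≥0 → Ω → Fin d → ℝ) (hX : IsLevyProcess X P) (hT : IsTransient X P) :
    ∀ᵐ ω ∂P, macroMinkowskiDim (processRange X ω) =
      ⨅ α ∈ {α : ℝ | 0 < α ∧
        ∫⁻ x, ENNReal.ofReal (1 / (1 + ‖x‖ ^ α)) ∂(potentialMeasure X P) < ∞}, (α : EReal) := by
  set W := {α : ℝ | 0 < α ∧
    ∫⁻ x, ENNReal.ofReal (1 / (1 + ‖x‖ ^ α)) ∂(potentialMeasure X P) < ∞}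
  have hupper : ∀ q : ℚ, (⨅ α ∈ W, (α : EReal)) < (q : ℝ) →
      ∀ᵐ ω ∂P, macroMinkowskiDim (processRange X ω) ≤ (q : ℝ) := by
    intro q hq
    obtain ⟨α, hα, hαq⟩ := by simpa only [iInf_lt_iff, exists_prop] using hq
    exact hX.ae_macroMinkowskiDim_le hα.1 (EReal.coe_lt_coe_iff.1 hαq) hα.2
  have hlower : ∀ q : ℚ, ((q : ℝ) : EReal) < (⨅ α ∈ W, (α : EReal)) →
      ∀ᵐ ω ∂P, ((q : ℝ) : EReal) ≤ macroMinkowskiDim (processRange X ω) := by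
    intro q hq
    rcases le_or_gt (q : ℝ) 0 with h0 | h0
    · refine ae_of_all _ fun ω => le_trans ?_ (macroMinkowskiDim_nonneg _)
      exact_mod_cast h0
    · obtain ⟨α, hqα, hαI⟩ := EReal.lt_iff_exists_real_btwn.1 hq
      have hqα' := EReal.coe_lt_coe_iff.1 hqα
      have hαW : α ∉ W := fun hα => absurd
        (iInf₂_le (f := fun (α : ℝ) (_ : α ∈ W) => (α : EReal)) α hα) (not_le.2 hαI)
      refine hX.ae_le_macroMinkowskiDim hT (h0.trans hqα') hqα' ?_
      by_contra hne
      exact hαW ⟨h0.trans hqα', lt_top_iff_ne_top.2 hne⟩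
  have hu := ae_all_iff.2 fun q => eventually_imp_distrib_left.2 (hupper q)
  have hl := ae_all_iff.2 fun q => eventually_imp_distrib_left.2 (hlower q)
  filter_upwards [hu, hl] with ω hω₁ hω₂
  refine le_antisymm (le_of_not_gt fun hlt => ?_) (le_of_not_gt fun hlt => ?_)
  · obtain ⟨q, hq, hq'⟩ := EReal.lt_iff_exists_rat_btwn.1 hlt
    exact not_le.2 hq' (hω₁ q hq)
  · obtain ⟨q, hq, hq'⟩ := EReal.lt_iff_exists_rat_btwn.1 hlt
    exact not_le.2 hq (hω₂ q hq')
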